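/- **Setting.** Let $n\ge 1$. * $f:\mathbb R\times[0,\infty)\to\mathbb R$ is bounded and continuous, there is a modulus of continuity $\omega_f$ with $|f(r,q_1)-f(r,q_2)|\le\omega_f(|q_1-q_2|)$ for all $r\in\mathbb R$, $q_1,q_2\ge0$, $f$ is nondecreasing in $r$, and $f$ is strictly increasing in $q$. * $\mu(A)=\int_A\Theta\,dx$ with $\Theta\in L^1(\mathbb R^n)$ and $\Theta>0$. * $u_0:\mathbb R^n\to\mathbb R$ is uniformly continuous, and $\lim_{R\to\infty}\inf\{u_0(y):|y|\ge R\}>u_0(x)$ for every $x$ (the limit may be $+\infty$). For $h,s\in\mathbb R$ put $D_h(0)=\{u_0<h\}$, $E_h(0)=\{u_0\le h\}$, and $$D_h(s)=\{x:\mathrm{sd}(x,D_h(0))<s\},\qquad E_h(s)=\{x:\mathrm{sd}(x,E_h(0))\le s\},$$ where $\mathrm{sd}(x,A)=\mathrm{dist}(x,A)-\mathrm{dist}(x,\mathbb R^n\setminus A)$ and $\mathrm{dist}(x,\emptyset)=+\infty$. For $W=D$ or $W=E$ consider the Lipschitz functions $\delta:[0,\infty)\to\mathbb R$ with $\delta(0)=0$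 and $$f\big(h,\mu(\mathrm{int}\,W_h(\delta(t)))\big)\le\delta'(t)\le f\big(h,\mu(\mathrm{cl}\,W_h(\delta(t)))\big)\quad\text{for a.e. }t\ge0.$$ Let $\delta_D(\cdot,h)$ be the minimal solution for $W=D$ and $\delta_E(\cdot,h)$ the maximal solution for $W=E$, that is, the pointwise infimum and the pointwise supremum of all solutions. Assume that $\overline h\in\mathbb R$ satisfies $$f\big(\overline h,\mu(D_{\overline h}(0))\big)\le0\le f\big(\overline h,\mu(E_{\overline h}(0))\big).\tag{1}$$ Let $u\in C(\mathbb R^n\times[0,\infty))$ be a viscosity solution of $$u_t+|\nabla u|\,f\big(u,\mu(\{u(\cdot,t)<u(x,t)\})\big)=0\ \text{ in }\mathbb R^n\times(0,\infty),\qquad u(\cdot,0)=u_0,$$ such that for every $T>0$ there is $M_T>0$ with $|u(x,t)|\le M_T(|x|+1)$ on $\mathbb R^n\times[0,T]$. Here subsolutions and supersolutions are tested with $C^1$ functions at local maxima and local minima, respectively, and in the supersolution inequality the set $\{u(\cdot,t)<u(x,t)\}$ is replaced by $\{u(\cdot,t)\le u(x,t)\}$. **Theorem.** Fix $h\ne\overline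 h$. The functions $\delta_D(\cdot,h)$ and $\delta_E(\cdot,h)$ are themselves solutions of the respective evolution problems, and the following hold. (a) Suppose that $\mathrm{cl}\,D_h(0)=E_h(0)$ if $h>\overline h$, respectively $D_h(0)=\mathrm{int}\,E_h(0)$ if $h<\overline h$. Then $\delta_D(t,h)=\delta_E(t,h)$ for all $t\ge0$. No fattening occurs at level $h$: for every $t\ge0$ the level set $\{u(\cdot,t)=h\}$ has empty interior, and $\mathrm{cl}\{u(\cdot,t)<h\}=\{u(\cdot,t)\le h\}$ if $h>\overline h$, respectively $\{u(\cdot,t)<h\}=\mathrm{int}\{u(\cdot,t)\le h\}$ if $h<\overline h$. Moreover, for every $t\ge0$, $$\{x:u(x,t)=h\}=\begin{cases}\partial D_h(\delta_D(t,h))&\text{if }h>\overline h,\\ \partial E_h(\delta_E(t,h))&\text{if }h<\overline h.\end{cases}$$ (b) Suppose that $\mathrm{cl}\,D_h(0)\subsetneq E_h(0)$ if $h>\overline h$, respectively $D_h(0)\subsetneq\mathrm{int}\,E_h(0)$ if $h<\overline h$, and that $h$ does not itself satisfy (1) in place of $\overline h$ (which is automatic when $\overline h$ is the only number satisfying (1)).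 Then $\delta_E(t,h)>\delta_D(t,h)$ for all $t>0$. -/

import Mathlib

open Set Filter Topology MeasureTheory
open scoped NNReal ENNReal

namespace NonlocalHJ

/-- A modulus of continuity on `[0, ∞)`. -/
structure IsModulus (ω : ℝ≥0 → ℝ≥0) : Prop where
  mono : Monotone ω
  zero : ω 0 = 0
  cont : ContinuousAt ω 0

/-- Assumptions on the velocity `f : ℝ × [0, ∞) → ℝ`: it is bounded and continuous, uniformly
continuous in the second variable with a modulus independent of the first, nondecreasing in the
first variable and strictly increasing in the second one. -/
structure IsVelocity (f : ℝ → ℝ≥0 → ℝ) : Prop where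
  bounded : ∃ M : ℝ, ∀ r q, |f r q| ≤ M
  continuous : Continuous (Function.uncurry f)
  modulus : ∃ ω : ℝ≥0 → ℝ≥0, IsModulus ω ∧
    ∀ r q₁ q₂, |f r q₁ - f r q₂| ≤ (ω (nndist q₁ q₂) : ℝ)
  mono_level : ∀ r₁ r₂ q, r₁ < r₂ → f r₁ q ≤ f r₂ q
  strict_mono_mass : ∀ r q₁ q₂, q₁ < q₂ → f r q₁ < f r q₂

section

variable {n : ℕ}

/-- Assumptions on the density: `Θ ∈ L¹(ℝⁿ)` and `Θ > 0`. -/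
structure IsDensity (Θ : EuclideanSpace ℝ (Fin n) → ℝ) : Prop where
  integrable : Integrable Θ volume
  pos : ∀ x, 0 < Θ x

/-- Assumptions on the initial value: uniform continuity, and coercivity
`lim_{R → ∞} inf {u₀ y : |y| ≥ R} > u₀ x` for all `x` (the limit may be `+∞`). -/
structure IsInitialValue (u₀ : EuclideanSpace ℝ (Fin n) → ℝ) : Prop where
  uniformContinuous : UniformContinuous u₀
  coercive : ∃ l : EReal,
    Tendsto (fun R : ℝ => ⨅ y : {y : EuclideanSpace ℝ (Fin n) // R ≤ ‖y‖}, (u₀ y : EReal))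
      atTop (𝓝 l) ∧
    ∀ x, (u₀ x : EReal) < l

/-- `μ(A) = ∫_A Θ dx`, as an element of `[0, ∞)`. -/
noncomputable def mass (Θ : EuclideanSpace ℝ (Fin n) → ℝ)
    (A : Set (EuclideanSpace ℝ (Fin n))) : ℝ≥0 :=
  (volume.withDensity (fun x => ENNReal.ofReal (Θ x)) A).toNNReal

/-- The signed distance `dist(x, A) - dist(x, ℝⁿ \ A)`, where the distance to the empty set
is `+∞`. -/
noncomputable def sgnDist (x : EuclideanSpace ℝ (Fin n))
    (A : Set (EuclideanSpace ℝ (Fin n))) : EReal :=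
  (Metric.infEDist x A : EReal) - (Metric.infEDist x Aᶜ : EReal)

/-- The open sublevel set `D_h(0) = {u₀ < h}`. -/
def subD (u₀ : EuclideanSpace ℝ (Fin n) → ℝ) (h : ℝ) : Set (EuclideanSpace ℝ (Fin n)) :=
  {x | u₀ x < h}

/-- The closed sublevel set `E_h(0) = {u₀ ≤ h}`. -/
def subE (u₀ : EuclideanSpace ℝ (Fin n) → ℝ) (h : ℝ) : Set (EuclideanSpace ℝ (Fin n)) :=
  {x | u₀ x ≤ h}

/-- The parallel set `D_h(s)`. -/
def parD (u₀ : EuclideanSpace ℝ (Fin n) → ℝ) (h s : ℝ) : Set (EuclideanSpace ℝ (Fin n)) :=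
  {x | sgnDist x (subD u₀ h) < (s : EReal)}

/-- The parallel set `E_h(s)`. -/
def parE (u₀ : EuclideanSpace ℝ (Fin n) → ℝ) (h s : ℝ) : Set (EuclideanSpace ℝ (Fin n)) :=
  {x | sgnDist x (subE u₀ h) ≤ (s : EReal)}

/-- `δ : [0, ∞) → ℝ` is a Lipschitz solution of
`f(h, μ(int W(δ(t)))) ≤ δ'(t) ≤ f(h, μ(cl W(δ(t))))` for a.e. `t ≥ 0`, with `δ(0) = 0`. -/
structure IsEvolution (f : ℝ → ℝ≥0 → ℝ) (Θ : EuclideanSpace ℝ (Fin n) → ℝ) (h : ℝ)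
    (W : ℝ → Set (EuclideanSpace ℝ (Fin n))) (δ : ℝ → ℝ) : Prop where
  lipschitz : ∃ K : ℝ≥0, LipschitzOnWith K δ (Ici 0)
  initial : δ 0 = 0
  inclusion : ∀ᵐ t ∂(volume.restrict (Ici (0 : ℝ))), ∃ v : ℝ, HasDerivAt δ v t ∧
    f h (mass Θ (interior (W (δ t)))) ≤ v ∧ v ≤ f h (mass Θ (closure (W (δ t))))

/-- The minimal solution of the evolution. -/
def IsMinimalEvolution (f : ℝ → ℝ≥0 → ℝ) (Θ : EuclideanSpace ℝ (Fin n) → ℝ) (h : ℝ)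
    (W : ℝ → Set (EuclideanSpace ℝ (Fin n))) (δ : ℝ → ℝ) : Prop :=
  IsEvolution f Θ h W δ ∧ ∀ η, IsEvolution f Θ h W η → ∀ t, 0 ≤ t → δ t ≤ η t

/-- The maximal solution of the evolution. -/
def IsMaximalEvolution (f : ℝ → ℝ≥0 → ℝ) (Θ : EuclideanSpace ℝ (Fin n) → ℝ) (h : ℝ)
    (W : ℝ → Set (EuclideanSpace ℝ (Fin n))) (δ : ℝ → ℝ) : Prop :=
  IsEvolution f Θ h W δ ∧ ∀ η, IsEvolution f Θ h W η → ∀ t, 0 ≤ t → η t ≤ δ t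

/-- `δ_D(t, h)`: the least value at time `t ≥ 0` of the solutions of the evolution of `D_h`. -/
noncomputable def deltaD (f : ℝ → ℝ≥0 → ℝ) (Θ : EuclideanSpace ℝ (Fin n) → ℝ)
    (u₀ : EuclideanSpace ℝ (Fin n) → ℝ) (t h : ℝ) : ℝ :=
  sInf {r | ∃ δ, IsEvolution f Θ h (parD u₀ h) δ ∧ δ t = r}

/-- `δ_E(t, h)`: the greatest value at time `t ≥ 0` of the solutions of the evolution of `E_h`. -/
noncomputable def deltaE (f : ℝ → ℝ≥0 → ℝ) (Θ : EuclideanSpace ℝ (Fin n) → ℝ)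
    (u₀ : EuclideanSpace ℝ (Fin n) → ℝ) (t h : ℝ) : ℝ :=
  sSup {r | ∃ δ, IsEvolution f Θ h (parE u₀ h) δ ∧ δ t = r}

/-- The condition `f(k, μ(D_k(0))) ≤ 0 ≤ f(k, μ(E_k(0)))` on a level `k`. -/
def IsThreshold (f : ℝ → ℝ≥0 → ℝ) (Θ : EuclideanSpace ℝ (Fin n) → ℝ)
    (u₀ : EuclideanSpace ℝ (Fin n) → ℝ) (k : ℝ) : Prop :=
  f k (mass Θ (subD u₀ k)) ≤ 0 ∧ 0 ≤ f k (mass Θ (subE u₀ k))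

/-- The open half space `ℝⁿ × (0, ∞)`. -/
def halfSpace (n : ℕ) : Set (EuclideanSpace ℝ (Fin n) × ℝ) := univ ×ˢ Ioi 0

/-- `u` is locally bounded in `ℝⁿ × (0, ∞)`. -/
def LocallyBdd (u : EuclideanSpace ℝ (Fin n) → ℝ → ℝ) : Prop :=
  ∀ p ∈ halfSpace n, ∃ s ∈ 𝓝 p, ∃ C : ℝ, ∀ q ∈ s, q ∈ halfSpace n → |u q.1 q.2| ≤ C

/-- Viscosity subsolutions of `u_t + |∇u| f(u, μ({u(·, t) < u(x, t)})) = 0`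
in `ℝⁿ × (0, ∞)`. -/
structure IsSubsolution (f : ℝ → ℝ≥0 → ℝ) (Θ : EuclideanSpace ℝ (Fin n) → ℝ)
    (u : EuclideanSpace ℝ (Fin n) → ℝ → ℝ) : Prop where
  locallyBdd : LocallyBdd u
  usc : UpperSemicontinuousOn (Function.uncurry u) (halfSpace n)
  test : ∀ (φ : EuclideanSpace ℝ (Fin n) × ℝ → ℝ), ContDiffOn ℝ 1 φ (halfSpace n) →
    ∀ (x₀ : EuclideanSpace ℝ (Fin n)) (t₀ : ℝ), 0 < t₀ →
    IsLocalMax (fun p : EuclideanSpace ℝ (Fin n) × ℝ => u p.1 p.2 - φ p) (x₀, t₀) →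
    deriv (fun t => φ (x₀, t)) t₀ + ‖gradient (fun x => φ (x, t₀)) x₀‖ *
      f (u x₀ t₀) (mass Θ {y | u y t₀ < u x₀ t₀}) ≤ 0

/-- Viscosity supersolutions of the same equation; the nonlocal term is evaluated on
`{u(·, t) ≤ u(x, t)}`. -/
structure IsSupersolution (f : ℝ → ℝ≥0 → ℝ) (Θ : EuclideanSpace ℝ (Fin n) → ℝ)
    (u : EuclideanSpace ℝ (Fin n) → ℝ → ℝ) : Prop where
  locallyBdd : LocallyBdd u
  lsc : LowerSemicontinuousOn (Function.uncurry u) (halfSpace n)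
  test : ∀ (φ : EuclideanSpace ℝ (Fin n) × ℝ → ℝ), ContDiffOn ℝ 1 φ (halfSpace n) →
    ∀ (x₀ : EuclideanSpace ℝ (Fin n)) (t₀ : ℝ), 0 < t₀ →
    IsLocalMin (fun p : EuclideanSpace ℝ (Fin n) × ℝ => u p.1 p.2 - φ p) (x₀, t₀) →
    0 ≤ deriv (fun t => φ (x₀, t)) t₀ + ‖gradient (fun x => φ (x, t₀)) x₀‖ *
      f (u x₀ t₀) (mass Θ {y | u y t₀ ≤ u x₀ t₀})

/-- `u` is a solution of the Cauchy problem with initial value `u₀`, continuous on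
`ℝⁿ × [0, ∞)` and of at most linear growth in `x`, locally uniformly in `t ≥ 0`. -/
structure IsCauchySolution (f : ℝ → ℝ≥0 → ℝ) (Θ : EuclideanSpace ℝ (Fin n) → ℝ)
    (u₀ : EuclideanSpace ℝ (Fin n) → ℝ) (u : EuclideanSpace ℝ (Fin n) → ℝ → ℝ) : Prop where
  continuousOn : ContinuousOn (Function.uncurry u) (univ ×ˢ Ici 0)
  sub : IsSubsolution f Θ u
  super : IsSupersolution f Θ u
  initial : ∀ x, u x 0 = u₀ x
  growth : ∀ T : ℝ, 0 < T → ∃ M : ℝ, 0 < M ∧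
    ∀ x, ∀ t ∈ Icc 0 T, |u x t| ≤ M * (‖x‖ + 1)

end

end NonlocalHJ

/-!
The level sets of a solution `u` do not interact: at a point with `u = h` the velocity is `f h` of
the mass of the sublevel set at level `h`, so this sublevel set moves with a normal velocity that
is constant in space. It therefore runs through the parallel sets of its initial position, and the
distance covered solves the scalar problem `y' = F(y)`, `y(0) = 0`, where `F(s)` is the velocity
belonging to the parallel set at distance `s`.

*Scalar problem.* `F` is bounded and nondecreasing, and it is right-continuous for `E_h` and
left-continuous for `D_h`. Picard iteration started above all solutions decreases to the maximal
solution (`exists_maximal_solution`). If `F` is continuous and bounded away from `0`, the travel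
time `∫₀ˢ 1/F` determines the solution, makes it depend continuously on `F`, and gives strict
comparison. Continuity of `F` at positive distances holds because spheres around a set are null
(`volume_cthickening_diff_thickening`).

*Duality.* `-u` solves the same kind of equation, with the velocity `dualSpeed f`; this exchanges
`D_h` and `E_h`, minimal and maximal solutions, and the levels below and above the threshold. Thus
it is enough to construct the maximal solution for `E_h` and to consider a level `h > hbar`. There
the velocity of `D_h` is positive, unless `D_h` is empty or the whole space (`speed_subD_pos`).

*Viscosity solutions.* Explicit barriers (`le_of_barrier`) show that a bound on the velocity
bounds the motion of a sublevel set. Conversely, a bound on the position of the sublevel set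
bounds its mass, hence its velocity. Iterating these two steps reproduces the Picard iteration and
gives the bounds `IsSuper.exists_expanding_bound` for `{u < k}` and, applied to `-u`,
`IsSuper.exists_shrinking_bound` for `{u > k}`. Letting `k ↓ h` in the first and `k ↑ h` in the
second encloses `{u ≤ h}` by the parallel set of `E_h` from outside (`IsFlow.outer_front`) and
`{u < h}` by that of `D_h` from inside (`IsFlow.inner_front`). If `closure D_h = E_h` the two
distances agree, and the level set is the boundary of the common parallel set
(`IsFlow.sublevel_eq_parD`). If the inclusion is proper, then `E_h` has strictly larger parallel
sets at small distances and moves faster (`deltaD_lt_deltaE`).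
-/

namespace NonlocalHJ

/-! ### Parallel sets -/

section Parallel

variable {V : Type*} [NormedAddCommGroup V] [NormedSpace ℝ V] [FiniteDimensional ℝ V]
  [MeasurableSpace V] [BorelSpace V]

/-- Spheres around a set are Lebesgue null: next to each of its points a sphere leaves out a ball
of comparable size, pointing towards the set, so the sphere has no density point. -/
theorem volume_cthickening_diff_thickening (μ : Measure V) [μ.IsAddHaarMeasure] (B : Set V) {s : ℝ}
    (hs : 0 < s) : μ (Metric.cthickening s B \ Metric.thickening s B) = 0 := by
  have : ProperSpace V := FiniteDimensional.proper ℝ V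
  set S := Metric.cthickening s B \ Metric.thickening s B with hS
  have hSm : MeasurableSet S :=
    Metric.isClosed_cthickening.measurableSet.diff Metric.isOpen_thickening.measurableSet
  rw [← Measure.restrict_eq_zero]
  have hae := (Besicovitch.ae_tendsto_measure_inter_div μ S).and
    (ae_restrict_mem (μ := μ) hSm)
  by_contra hne
  have : (ae (μ.restrict S)).NeBot := ae_neBot.2 hne
  obtain ⟨x, hx, hxS⟩ := hae.exists
  obtain ⟨hx1, hx2⟩ := hxS
  have hBne : (closure B).Nonempty := by
    by_contra hB
    rw [not_nonempty_iff_eq_empty, closure_empty_iff] at hB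
    simp [hB] at hx1
  obtain ⟨z, hz, hxz⟩ := isClosed_closure.exists_infDist_eq_dist hBne x
  have hBne' : B.Nonempty := closure_nonempty_iff.1 hBne
  have hd : dist x z = s := by
    rw [← hxz, Metric.infDist_closure]
    refine le_antisymm (ENNReal.toReal_le_of_le_ofReal hs.le hx1)
      (not_lt.1 fun hlt => hx2 ((Metric.mem_thickening_iff_infDist_lt hBne').2 hlt))
  set N := Module.finrank ℝ V
  set c : ℝ≥0∞ := ENNReal.ofReal ((1 / 2 : ℝ) ^ N) with hc
  have hc0 : 0 < c := ENNReal.ofReal_pos.2 (by positivity)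
  have hc1 : c ≠ ∞ := ENNReal.ofReal_ne_top
  have hub : ∀ᶠ r in 𝓝[>] (0 : ℝ),
      μ (S ∩ Metric.closedBall x r) / μ (Metric.closedBall x r) ≤ 1 - c := by
    filter_upwards [Ioo_mem_nhdsGT hs] with r hr
    obtain ⟨hr0, hrs⟩ := hr
    set p : V := x + (r / 2 / s) • (z - x) with hp
    have hzx : ‖z - x‖ = s := by rw [← dist_eq_norm, dist_comm, hd]
    have hpx : dist p x = r / 2 := by
      rw [dist_eq_norm, hp, add_sub_cancel_left, norm_smul, hzx,
        Real.norm_of_nonneg (by positivity)]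
      field_simp
    have hpz : dist p z = s - r / 2 := by
      have : p - z = (r / 2 / s - 1) • (z - x) := by rw [hp, sub_smul, one_smul]; abel
      rw [dist_eq_norm, this, norm_smul, hzx, Real.norm_eq_abs, abs_of_nonpos]
      · field_simp; ring
      · rw [sub_nonpos, div_le_one hs]; linarith
    have hball : Metric.ball p (r / 2) ⊆ Metric.closedBall x r \ S := by
      intro w hw
      rw [Metric.mem_ball] at hw
      refine ⟨?_, fun hwS => hwS.2 ?_⟩
      · rw [Metric.mem_closedBall]
        linarith [dist_triangle w p x]
      · rw [← Metric.thickening_closure, Metric.mem_thickening_iff]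
        exact ⟨z, hz, by linarith [dist_triangle w p z]⟩
    have hb : μ (Metric.ball p (r / 2)) = c * μ (Metric.closedBall x r) := by
      rw [Measure.addHaar_ball_of_pos μ p (by positivity), Measure.addHaar_closedBall μ x hr0.le,
        ← mul_assoc, hc, ← ENNReal.ofReal_mul (by positivity), ← mul_pow]
      congr 3; ring
    have hcb0 : μ (Metric.closedBall x r) ≠ 0 := (Metric.measure_closedBall_pos μ x hr0).ne'
    have hcbt : μ (Metric.closedBall x r) ≠ ∞ := measure_closedBall_lt_top.ne
    rw [ENNReal.div_le_iff hcb0 hcbt, ENNReal.sub_mul (fun _ _ => hcbt), one_mul, ← hb]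
    calc μ (S ∩ Metric.closedBall x r) ≤ μ (Metric.closedBall x r \ Metric.ball p (r / 2)) := by
          refine measure_mono fun w hw => ⟨hw.2, fun hwb => (hball hwb).2 hw.1⟩
      _ = _ := measure_sdiff (hball.trans sdiff_subset) measurableSet_ball.nullMeasurableSet
          measure_ball_lt_top.ne
  have := le_of_tendsto hx hub
  exact absurd this (not_le.2 (ENNReal.sub_lt_self ENNReal.one_ne_top one_ne_zero hc0.ne'))

end Parallel

section Sets

variable {n : ℕ}

theorem sgnDist_le_iff_of_nonneg {x : EuclideanSpace ℝ (Fin n)}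
    {A : Set (EuclideanSpace ℝ (Fin n))} {s : ℝ} (hs : 0 ≤ s) :
    sgnDist x A ≤ (s : EReal) ↔ Metric.infEDist x A ≤ ENNReal.ofReal s := by
  have hs' : (s : EReal) = (ENNReal.ofReal s : EReal) := by
    rw [EReal.coe_ennreal_ofReal, max_eq_left hs]
  unfold sgnDist
  by_cases hx : x ∈ A
  · rw [Metric.infEDist_zero_of_mem hx]
    simp only [EReal.coe_ennreal_zero, zero_sub, zero_le, iff_true]
    exact (EReal.neg_le_neg_iff.2 (EReal.coe_ennreal_nonneg _)).trans
      (by simpa using EReal.coe_nonneg.2 hs)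
  · rw [Metric.infEDist_zero_of_mem (s := Aᶜ) hx, EReal.coe_ennreal_zero, sub_zero, hs',
      EReal.coe_ennreal_le_coe_ennreal_iff]

theorem sgnDist_compl (x : EuclideanSpace ℝ (Fin n)) (A : Set (EuclideanSpace ℝ (Fin n))) :
    sgnDist x Aᶜ = -sgnDist x A := by
  unfold sgnDist
  by_cases hx : x ∈ A
  · rw [Metric.infEDist_zero_of_mem hx, compl_compl, Metric.infEDist_zero_of_mem hx]
    simp
  · rw [Metric.infEDist_zero_of_mem (s := Aᶜ) hx, compl_compl]
    simp

theorem sgnDist_lt_iff_of_pos {x : EuclideanSpace ℝ (Fin n)}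
    {A : Set (EuclideanSpace ℝ (Fin n))} {s : ℝ} (hs : 0 < s) :
    sgnDist x A < (s : EReal) ↔ Metric.infEDist x A < ENNReal.ofReal s := by
  have hs' : (s : EReal) = (ENNReal.ofReal s : EReal) := by
    rw [EReal.coe_ennreal_ofReal, max_eq_left hs.le]
  unfold sgnDist
  by_cases hx : x ∈ A
  · rw [Metric.infEDist_zero_of_mem hx]
    simp only [EReal.coe_ennreal_zero, zero_sub, ENNReal.ofReal_pos, hs, iff_true]
    exact (EReal.neg_le_neg_iff.2 (EReal.coe_ennreal_nonneg _)).trans_lt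
      (by simpa using EReal.coe_pos.2 hs)
  · rw [Metric.infEDist_zero_of_mem (s := Aᶜ) hx, EReal.coe_ennreal_zero, sub_zero, hs',
      EReal.coe_ennreal_lt_coe_ennreal_iff]

theorem sgnDist_lt_iff_of_nonpos {x : EuclideanSpace ℝ (Fin n)}
    {A : Set (EuclideanSpace ℝ (Fin n))} {s : ℝ} (hs : s ≤ 0) :
    sgnDist x A < (s : EReal) ↔ ENNReal.ofReal (-s) < Metric.infEDist x Aᶜ := by
  have := sgnDist_le_iff_of_nonneg (x := x) (A := Aᶜ) (s := -s) (by linarith)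
  rw [← not_le, ← not_le, ← this, sgnDist_compl, EReal.coe_neg, EReal.neg_le_neg_iff]

variable {u₀ : EuclideanSpace ℝ (Fin n) → ℝ} {h s : ℝ}

theorem parE_eq_cthickening (hs : 0 ≤ s) : parE u₀ h s = Metric.cthickening s (subE u₀ h) := by
  ext x
  exact sgnDist_le_iff_of_nonneg hs

theorem parD_eq_thickening (hs : 0 < s) : parD u₀ h s = Metric.thickening s (subD u₀ h) := by
  ext x
  exact sgnDist_lt_iff_of_pos hs

theorem subE_neg : subE (-u₀) (-h) = (subD u₀ h)ᶜ := by
  ext x; simp [subE, subD]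

theorem subD_neg : subD (-u₀) (-h) = (subE u₀ h)ᶜ := by
  ext x; simp [subE, subD]

theorem parD_neg : parD (-u₀) (-h) (-s) = (parE u₀ h s)ᶜ := by
  ext x
  simp only [parD, parE, subD_neg, sgnDist_compl, mem_ofPred_eq, mem_compl_iff, not_le,
    EReal.coe_neg, EReal.neg_lt_neg_iff]

theorem parE_neg : parE (-u₀) (-h) (-s) = (parD u₀ h s)ᶜ := by
  ext x
  simp only [parD, parE, subE_neg, sgnDist_compl, mem_ofPred_eq, mem_compl_iff, not_lt,
    EReal.coe_neg, EReal.neg_le_neg_iff]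

theorem monotone_parE : Monotone (parE u₀ h) := fun _ _ hst _ hx =>
  le_trans (b := _) hx (EReal.coe_le_coe_iff.2 hst)

theorem monotone_parD : Monotone (parD u₀ h) := fun _ _ hst _ hx =>
  lt_of_lt_of_le (b := _) hx (EReal.coe_le_coe_iff.2 hst)

theorem isOpen_parD : IsOpen (parD u₀ h s) := by
  rcases lt_or_ge 0 s with hs | hs
  · rw [parD_eq_thickening hs]
    exact Metric.isOpen_thickening
  · have : parD u₀ h s = {x | ENNReal.ofReal (-s) < Metric.infEDist x (subD u₀ h)ᶜ} := by
      ext x; exact sgnDist_lt_iff_of_nonpos hs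
    rw [this]
    exact isOpen_lt continuous_const Metric.continuous_infEDist

theorem isClosed_parE : IsClosed (parE u₀ h s) := by
  have := isOpen_parD (u₀ := -u₀) (h := -h) (s := -s)
  rwa [parD_neg, isOpen_compl_iff] at this

theorem isOpen_subD (hu : Continuous u₀) : IsOpen (subD u₀ h) :=
  isOpen_lt hu continuous_const

theorem isClosed_subE (hu : Continuous u₀) : IsClosed (subE u₀ h) :=
  isClosed_le hu continuous_const

theorem parD_zero (hu : Continuous u₀) : parD u₀ h 0 = subD u₀ h := by
  ext x
  have h1 := sgnDist_lt_iff_of_nonpos (x := x) (A := subD u₀ h) (le_refl (0 : ℝ))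
  have h2 : IsClosed (subD u₀ h)ᶜ := (isOpen_subD hu).isClosed_compl
  simp only [parD, mem_ofPred_eq, h1, neg_zero, ENNReal.ofReal_zero]
  rw [pos_iff_ne_zero, ne_eq, ← Metric.mem_closure_iff_infEDist_zero, h2.closure_eq,
    mem_compl_iff, not_not]

end Sets

/-! ### Masses -/

section Mass

variable {n : ℕ} {Θ : EuclideanSpace ℝ (Fin n) → ℝ}

theorem IsDensity.isFiniteMeasure (hΘ : IsDensity Θ) :
    IsFiniteMeasure (volume.withDensity (fun x => ENNReal.ofReal (Θ x))) :=
  isFiniteMeasure_withDensity_ofReal hΘ.integrable.2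

theorem mass_mono (hΘ : IsDensity Θ) {A B : Set (EuclideanSpace ℝ (Fin n))} (hAB : A ⊆ B) :
    mass Θ A ≤ mass Θ B := by
  have := hΘ.isFiniteMeasure
  exact ENNReal.toNNReal_mono (measure_ne_top _ _) (measure_mono hAB)

theorem mass_lt (hΘ : IsDensity Θ) {A B U : Set (EuclideanSpace ℝ (Fin n))} (hAB : A ⊆ B)
    (hA : MeasurableSet A) (hU : IsOpen U) (hne : U.Nonempty) (hUB : U ⊆ B \ A) :
    mass Θ A < mass Θ B := by
  have := hΘ.isFiniteMeasure
  refine (ENNReal.toNNReal_lt_toNNReal (measure_ne_top _ _) (measure_ne_top _ _)).2 ?_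
  refine lt_of_le_of_ne (measure_mono hAB) fun heq => ?_
  have h0 : (volume.withDensity (fun x => ENNReal.ofReal (Θ x))) (B \ A) = 0 := by
    rw [measure_sdiff hAB hA.nullMeasurableSet (measure_ne_top _ _), heq, tsub_self]
  have h1 := measure_mono_null hUB h0
  rw [withDensity_apply_eq_zero' hΘ.integrable.aemeasurable.ennreal_ofReal] at h1
  have h2 : {x | ENNReal.ofReal (Θ x) ≠ 0} ∩ U = U := by
    refine inter_eq_right.2 fun x _ => ?_
    simpa using hΘ.pos x
  rw [h2] at h1
  exact (hU.measure_pos volume hne).ne' h1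

theorem mass_compl (hΘ : IsDensity Θ) {A : Set (EuclideanSpace ℝ (Fin n))}
    (hA : MeasurableSet A) : mass Θ Aᶜ = mass Θ univ - mass Θ A := by
  have := hΘ.isFiniteMeasure
  unfold mass
  rw [measure_compl hA (measure_ne_top _ _),
    ENNReal.toNNReal_sub (measure_ne_top _ _)]

theorem tendsto_mass (hΘ : IsDensity Θ) {ι : Type*} {L : Filter ι} [L.IsCountablyGenerated]
    {A : ι → Set (EuclideanSpace ℝ (Fin n))} {B : Set (EuclideanSpace ℝ (Fin n))}
    (hA : ∀ i, MeasurableSet (A i)) (hB : MeasurableSet B)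
    (hlim : ∀ᵐ x, ∀ᶠ i in L, x ∈ A i ↔ x ∈ B) :
    Tendsto (fun i => mass Θ (A i)) L (𝓝 (mass Θ B)) := by
  have := hΘ.isFiniteMeasure
  refine (ENNReal.tendsto_toNNReal (measure_ne_top _ _)).comp ?_
  exact tendsto_measure_of_ae_tendsto_indicator_of_isFiniteMeasure L hB hA
    ((withDensity_absolutelyContinuous _ _).ae_le hlim)

theorem ae_infEDist_ne (B : Set (EuclideanSpace ℝ (Fin n))) {s : ℝ} (hs : 0 < s) :
    ∀ᵐ x, Metric.infEDist x B ≠ ENNReal.ofReal s := by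
  refine measure_mono_null (fun x hx => ?_) (volume_cthickening_diff_thickening volume B hs)
  simp only [ne_eq, mem_compl_iff, mem_ofPred_eq, not_not] at hx
  exact ⟨hx.le, fun h => (ne_of_lt h) hx⟩

theorem mass_congr {A B : Set (EuclideanSpace ℝ (Fin n))}
    (hAB : ∀ᵐ x, x ∈ A ↔ x ∈ B) : mass Θ A = mass Θ B := by
  unfold mass
  congr 1
  exact measure_congr ((withDensity_absolutelyContinuous _ _).ae_le
    (hAB.mono fun x hx => propext hx))

theorem mass_thickening (B : Set (EuclideanSpace ℝ (Fin n))) {s : ℝ}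
    (hs : 0 < s) : mass Θ (Metric.thickening s B) = mass Θ (Metric.cthickening s B) := by
  refine mass_congr ?_
  filter_upwards [ae_infEDist_ne B hs] with x hx
  exact ⟨fun h => Metric.thickening_subset_cthickening s B h, fun h => lt_of_le_of_ne h hx⟩

theorem continuous_mass_cthickening (hΘ : IsDensity Θ) (B : Set (EuclideanSpace ℝ (Fin n))) :
    Continuous fun s => mass Θ (Metric.cthickening s B) := by
  refine continuous_iff_continuousAt.2 fun s => ?_
  refine tendsto_mass hΘ (fun _ => Metric.isClosed_cthickening.measurableSet)
    Metric.isClosed_cthickening.measurableSet ?_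
  have hcont : Tendsto ENNReal.ofReal (𝓝 s) (𝓝 (ENNReal.ofReal s)) :=
    ENNReal.continuous_ofReal.continuousAt
  have key : ∀ x, (0 < s → Metric.infEDist x B ≠ ENNReal.ofReal s) →
      ∀ᶠ r in 𝓝 s, x ∈ Metric.cthickening r B ↔ x ∈ Metric.cthickening s B := by
    intro x hx
    simp only [Metric.mem_cthickening_iff]
    rcases lt_trichotomy (Metric.infEDist x B) (ENNReal.ofReal s) with h | h | h
    · filter_upwards [hcont.eventually_const_lt h] with r hr
      exact iff_of_true hr.le h.le
    · have hs : s ≤ 0 := not_lt.1 fun h0 => hx h0 h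
      rw [h, ENNReal.ofReal_of_nonpos hs]
      simp
    · filter_upwards [hcont.eventually_lt_const h] with r hr
      exact iff_of_false (not_le.2 hr) (not_le.2 h)
  rcases lt_or_ge 0 s with hs | hs
  · filter_upwards [ae_infEDist_ne B hs] with x hx using key x fun _ => hx
  · exact Eventually.of_forall fun x => key x fun h => absurd h (not_lt.2 hs)

end Mass

/-! ### Scalar evolutions with monotone right-hand side -/

section ODE

/-- The Picard iterates of `y = ∫₀ F(y)`, started from the upper bound `M t` of all solutions. -/
noncomputable def picard (F : ℝ → ℝ) (M : ℝ) : ℕ → ℝ → ℝ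
  | 0 => fun t => M * t
  | k + 1 => fun t => ∫ s in (0 : ℝ)..t, F (picard F M k s)

variable {F : ℝ → ℝ} {M : ℝ}

theorem intervalIntegrable_comp (hF : Monotone F) (hM : ∀ s, |F s| ≤ M) {y : ℝ → ℝ}
    (hy : Measurable y) (a b : ℝ) : IntervalIntegrable (fun s => F (y s)) volume a b := by
  refine (intervalIntegrable_const (c := M)).mono_fun
    (hF.measurable.comp hy).aestronglyMeasurable (Eventually.of_forall fun s => ?_)
  exact (hM _).trans (le_abs_self M)

theorem continuous_picard (hF : Monotone F) (hM : ∀ s, |F s| ≤ M) (k : ℕ) :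
    Continuous (picard F M k) := by
  induction k with
  | zero => exact continuous_const.mul continuous_id
  | succ k ih =>
    exact intervalIntegral.continuous_primitive
      (fun a b => intervalIntegrable_comp hF hM ih.measurable a b) 0

theorem integral_comp_mono (hF : Monotone F) (hM : ∀ s, |F s| ≤ M) {x y : ℝ → ℝ}
    (hx : Measurable x) (hy : Measurable y) (hxy : ∀ t, 0 ≤ t → x t ≤ y t) {t : ℝ} (ht : 0 ≤ t) :
    ∫ s in (0 : ℝ)..t, F (x s) ≤ ∫ s in (0 : ℝ)..t, F (y s) :=
  intervalIntegral.integral_mono_on ht (intervalIntegrable_comp hF hM hx 0 t)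
    (intervalIntegrable_comp hF hM hy 0 t) fun s hs => hF (hxy s hs.1)

theorem abs_integral_comp_le (hM : ∀ s, |F s| ≤ M) (y : ℝ → ℝ) {t : ℝ} (ht : 0 ≤ t) :
    |∫ s in (0 : ℝ)..t, F (y s)| ≤ M * t := by
  have := intervalIntegral.norm_integral_le_of_norm_le_const (a := 0) (b := t)
    (f := fun s => F (y s)) (C := M) fun s _ => hM _
  rwa [sub_zero, abs_of_nonneg ht] at this

theorem picard_succ_le (hF : Monotone F) (hM : ∀ s, |F s| ≤ M) (k : ℕ) {t : ℝ} (ht : 0 ≤ t) :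
    picard F M (k + 1) t ≤ picard F M k t := by
  induction k generalizing t with
  | zero => exact (le_abs_self _).trans (abs_integral_comp_le hM _ ht)
  | succ k ih =>
    exact integral_comp_mono hF hM (continuous_picard hF hM _).measurable
      (continuous_picard hF hM _).measurable (fun s hs => ih hs) ht

theorem neg_le_picard (hM : ∀ s, |F s| ≤ M) (k : ℕ) {t : ℝ} (ht : 0 ≤ t) :
    -(M * t) ≤ picard F M k t := by
  cases k with
  | zero =>
    have : 0 ≤ M := (abs_nonneg _).trans (hM 0)
    have : 0 ≤ M * t := by positivity
    show -(M * t) ≤ M * t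
    linarith
  | succ k => exact neg_le_of_abs_le (abs_integral_comp_le hM _ ht)

theorem le_picard (hF : Monotone F) (hM : ∀ s, |F s| ≤ M) {x : ℝ → ℝ} (hx : Measurable x)
    (hxF : ∀ t, 0 ≤ t → x t ≤ ∫ s in (0 : ℝ)..t, F (x s)) (k : ℕ) {t : ℝ} (ht : 0 ≤ t) :
    x t ≤ picard F M k t := by
  induction k generalizing t with
  | zero =>
    exact (hxF t ht).trans ((le_abs_self _).trans (abs_integral_comp_le hM _ ht))
  | succ k ih =>
    exact (hxF t ht).trans (integral_comp_mono hF hM hx (continuous_picard hF hM _).measurable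
      (fun s hs => ih hs) ht)

/-- For a nondecreasing, right-continuous and bounded `F` the Picard iterates from above decrease
to a solution of `y = ∫₀ F(y)` which dominates all subsolutions. Right-continuity suffices because
the iterates approach their limit from above. -/
theorem exists_maximal_solution (hF : Monotone F) (hM : ∀ s, |F s| ≤ M)
    (hr : ∀ s, ContinuousWithinAt F (Ici s) s) :
    ∃ y : ℝ → ℝ, Continuous y ∧ (∀ t, 0 ≤ t → y t = ∫ s in (0 : ℝ)..t, F (y s)) ∧
      (∀ t, 0 ≤ t → Tendsto (fun k => picard F M k t) atTop (𝓝 (y t))) ∧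
      ∀ x : ℝ → ℝ, Measurable x → (∀ t, 0 ≤ t → x t ≤ ∫ s in (0 : ℝ)..t, F (x s)) →
        ∀ t, 0 ≤ t → x t ≤ y t := by
  set z : ℝ → ℝ := fun t => ⨅ k, picard F M k t with hz
  have hzm : Measurable z := Measurable.iInf fun k => (continuous_picard hF hM k).measurable
  have hbdd : ∀ t, 0 ≤ t → BddBelow (range fun k => picard F M k t) := fun t ht =>
    ⟨-(M * t), by rintro _ ⟨k, rfl⟩; exact neg_le_picard hM k ht⟩
  have hlim : ∀ t, 0 ≤ t → Tendsto (fun k => picard F M k t) atTop (𝓝 (z t)) := fun t ht =>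
    tendsto_atTop_ciInf (antitone_nat_of_succ_le fun k => picard_succ_le hF hM k ht) (hbdd t ht)
  have hzF : ∀ t, 0 ≤ t → z t = ∫ s in (0 : ℝ)..t, F (z s) := by
    intro t ht
    refine tendsto_nhds_unique ((tendsto_add_atTop_iff_nat 1).2 (hlim t ht)) ?_
    refine intervalIntegral.tendsto_integral_filter_of_dominated_convergence (fun _ => M)
      (Eventually.of_forall fun k => (hF.measurable.comp
        (continuous_picard hF hM k).measurable).aestronglyMeasurable)
      (Eventually.of_forall fun k => Eventually.of_forall fun s _ => hM _)
      intervalIntegrable_const (Eventually.of_forall fun s hs => ?_)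
    rw [uIoc_of_le ht] at hs
    refine (hr (z s)).tendsto.comp (tendsto_nhdsWithin_iff.2 ⟨hlim s hs.1.le, ?_⟩)
    exact Eventually.of_forall fun k => ciInf_le (hbdd s hs.1.le) k
  set y : ℝ → ℝ := fun t => ∫ s in (0 : ℝ)..t, F (z s) with hy
  have hyz : ∀ t, 0 ≤ t → y t = z t := fun t ht => (hzF t ht).symm
  refine ⟨y, intervalIntegral.continuous_primitive
    (fun a b => intervalIntegrable_comp hF hM hzm a b) 0, fun t ht => ?_, fun t ht => ?_,
    fun x hx hxF t ht => ?_⟩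
  · refine intervalIntegral.integral_congr fun s hs => ?_
    rw [uIcc_of_le ht] at hs
    simp only [hyz s hs.1]
  · rw [hyz t ht]; exact hlim t ht
  · rw [hyz t ht]
    exact le_ciInf fun k => le_picard hF hM hx hxF k ht

theorem ae_hasDerivAt_of_eq_integral (hF : Monotone F) (hM : ∀ s, |F s| ≤ M) {y : ℝ → ℝ}
    (hy : Continuous y) (hyF : ∀ t, 0 ≤ t → y t = ∫ s in (0 : ℝ)..t, F (y s)) :
    ∀ᵐ t ∂(volume.restrict (Ici (0 : ℝ))), HasDerivAt y (F (y t)) t := by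
  have hloc : LocallyIntegrable (fun s => F (y s)) volume := by
    refine (locallyIntegrable_const M).mono (hF.measurable.comp hy.measurable).aestronglyMeasurable
      (Eventually.of_forall fun s => ?_)
    exact (hM _).trans (le_abs_self M)
  have h1 := LocallyIntegrable.ae_hasDerivAt_integral hloc
  rw [← restrict_Ioi_eq_restrict_Ici]
  filter_upwards [ae_restrict_of_ae h1, ae_restrict_mem measurableSet_Ioi] with t ht htpos
  refine (ht 0).congr_of_eventuallyEq ?_
  filter_upwards [Ioi_mem_nhds htpos] with s hs using hyF s (le_of_lt hs)

theorem lipschitzOnWith_of_eq_integral (hF : Monotone F) (hM : ∀ s, |F s| ≤ M) {y : ℝ → ℝ}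
    (hy : Continuous y) (hyF : ∀ t, 0 ≤ t → y t = ∫ s in (0 : ℝ)..t, F (y s)) :
    LipschitzOnWith M.toNNReal y (Ici 0) := by
  have hM0 : 0 ≤ M := (abs_nonneg _).trans (hM 0)
  refine LipschitzOnWith.of_dist_le_mul fun s hs t ht => ?_
  rw [Real.coe_toNNReal _ hM0, Real.dist_eq, hyF s hs, hyF t ht,
    intervalIntegral.integral_interval_sub_left (intervalIntegrable_comp hF hM hy.measurable _ _)
      (intervalIntegrable_comp hF hM hy.measurable _ _)]
  exact intervalIntegral.norm_integral_le_of_norm_le_const (f := fun r => F (y r)) fun r _ => hM _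

theorem nonneg_of_eq_integral (hF : Monotone F) (hM : ∀ s, |F s| ≤ M) {y : ℝ → ℝ}
    (hy : Continuous y) (hyF : ∀ t, 0 ≤ t → y t = ∫ s in (0 : ℝ)..t, F (y s)) {σ : ℝ}
    (hσ : 0 < σ) (hpos : ∀ s, -σ < s → 0 ≤ F s) {t : ℝ} (ht : 0 ≤ t) : 0 ≤ y t := by
  by_contra hlt
  rw [not_le] at hlt
  have hS : IsCompact (Icc 0 t ∩ {s | 0 ≤ y s}) :=
    isCompact_Icc.inter_right (isClosed_le continuous_const hy)
  have hy0 : y 0 = 0 := by rw [hyF 0 le_rfl]; simp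
  obtain ⟨a, ⟨⟨ha0, hat⟩, hya⟩, hmax⟩ := hS.exists_isGreatest ⟨0, ⟨le_rfl, ht⟩, hy0.ge⟩
  have hat' : a < t := lt_of_le_of_ne hat fun h => by
    subst h; exact absurd hya (not_le.2 hlt)
  have hnear : ∀ᶠ s in 𝓝 a, -σ < y s :=
    hy.continuousAt.eventually_const_lt (lt_of_lt_of_le (by linarith) hya)
  obtain ⟨r, hr, hball⟩ := Metric.eventually_nhds_iff_ball.1 hnear
  set b := min t (a + r / 2) with hb
  have hab : a < b := lt_min hat' (by linarith)
  have hbt : b ≤ t := min_le_left _ _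
  have hbr : b ≤ a + r / 2 := min_le_right _ _
  have hyb : y b - y a = ∫ s in a..b, F (y s) := by
    rw [hyF a ha0, hyF b (ha0.trans hab.le), intervalIntegral.integral_interval_sub_left
      (intervalIntegrable_comp hF hM hy.measurable _ _)
      (intervalIntegrable_comp hF hM hy.measurable _ _)]
  have hint : 0 ≤ ∫ s in a..b, F (y s) := by
    refine intervalIntegral.integral_nonneg hab.le fun s hs => hpos _ (hball s ?_)
    rw [Metric.mem_ball, Real.dist_eq, abs_lt]
    constructor <;> linarith [hs.1, hs.2]
  have hya' : 0 ≤ y a := hya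
  have hyb' : 0 ≤ y b := by linarith
  exact absurd (hmax ⟨⟨ha0.trans hab.le, hbt⟩, hyb'⟩) (not_le.2 hab)

/-! #### Positive right-hand sides -/

/-- The time which a solution of `y' = F(y)` needs for the way from `0` to `s`. -/
noncomputable def travelTime (F : ℝ → ℝ) (s : ℝ) : ℝ := ∫ r in (0 : ℝ)..s, (F r)⁻¹

variable {c : ℝ}

theorem continuous_inv_of_pos (hF : Continuous F) (hc : 0 < c) (hcF : ∀ s, c ≤ F s) :
    Continuous fun r => (F r)⁻¹ :=
  hF.inv₀ fun s => (hc.trans_le (hcF s)).ne'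

theorem travelTime_strictMono (hF : Continuous F) (hc : 0 < c) (hcF : ∀ s, c ≤ F s) :
    StrictMono (travelTime F) := by
  refine strictMono_of_hasDerivAt_pos (f' := fun r => (F r)⁻¹) (fun s => ?_)
    fun s => inv_pos.2 (hc.trans_le (hcF s))
  exact (continuous_inv_of_pos hF hc hcF).integral_hasStrictDerivAt 0 s |>.hasDerivAt

theorem travelTime_solution (hF : Continuous F) (hc : 0 < c) (hcF : ∀ s, c ≤ F s) {y : ℝ → ℝ}
    (hy : Continuous y) (hyF : ∀ t, 0 ≤ t → y t = ∫ s in (0 : ℝ)..t, F (y s)) {t : ℝ}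
    (ht : 0 ≤ t) : travelTime F (y t) = t := by
  set Y : ℝ → ℝ := fun t => ∫ s in (0 : ℝ)..t, F (y s) with hY
  have hYd : ∀ s, HasDerivAt Y (F (y s)) s := fun s =>
    ((hF.comp hy).integral_hasStrictDerivAt 0 s).hasDerivAt
  have hTd : ∀ s, HasDerivAt (travelTime F) (F s)⁻¹ s := fun s =>
    ((continuous_inv_of_pos hF hc hcF).integral_hasStrictDerivAt 0 s).hasDerivAt
  have hd : ∀ s, HasDerivAt (fun s => travelTime F (Y s) - s) ((F (Y s))⁻¹ * F (y s) - 1) s :=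
    fun s => ((hTd (Y s)).comp s (hYd s)).sub (hasDerivAt_id s)
  have := constant_of_has_deriv_right_zero (f := fun s => travelTime F (Y s) - s) (a := 0) (b := t)
    (fun s _ => (hd s).continuousAt.continuousWithinAt) (fun s hs => by
      have := (hd s).hasDerivWithinAt (s := Ici s)
      rwa [show Y s = y s from (hyF s hs.1).symm,
        inv_mul_cancel₀ (hc.trans_le (hcF _)).ne', sub_self] at this)
    t ⟨ht, le_rfl⟩
  have h0 : Y 0 = 0 := by simp [hY]
  have h1 : travelTime F 0 = 0 := by simp [travelTime]
  simp only [h0, h1, sub_zero] at this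
  rw [hyF t ht]
  linarith

theorem solution_unique (hF : Continuous F) (hc : 0 < c) (hcF : ∀ s, c ≤ F s) {y z : ℝ → ℝ}
    (hy : Continuous y) (hyF : ∀ t, 0 ≤ t → y t = ∫ s in (0 : ℝ)..t, F (y s))
    (hz : Continuous z) (hzF : ∀ t, 0 ≤ t → z t = ∫ s in (0 : ℝ)..t, F (z s)) {t : ℝ}
    (ht : 0 ≤ t) : y t = z t :=
  (travelTime_strictMono hF hc hcF).injective ((travelTime_solution hF hc hcF hy hyF ht).trans
    (travelTime_solution hF hc hcF hz hzF ht).symm)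

theorem mul_le_solution (hF : Continuous F) (hcF : ∀ s, c ≤ F s) {y : ℝ → ℝ}
    (hy : Continuous y) (hyF : ∀ t, 0 ≤ t → y t = ∫ s in (0 : ℝ)..t, F (y s)) {t : ℝ}
    (ht : 0 ≤ t) : c * t ≤ y t := by
  rw [hyF t ht]
  have := intervalIntegral.integral_mono_on ht (intervalIntegrable_const (μ := volume) (c := c))
    ((hF.comp hy).intervalIntegrable 0 t) fun s _ => hcF (y s)
  simpa [mul_comm] using this

theorem solution_strict_mono {G : ℝ → ℝ} (hF : Continuous F) (hc : 0 < c) (hcF : ∀ s, c ≤ F s)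
    (hG : Continuous G) (hFG : ∀ s, F s ≤ G s) {r : ℝ} (hr : 0 < r)
    (hlt : ∀ s, 0 < s → s < r → F s < G s) {y z : ℝ → ℝ}
    (hy : Continuous y) (hyF : ∀ t, 0 ≤ t → y t = ∫ s in (0 : ℝ)..t, F (y s))
    (hz : Continuous z) (hzG : ∀ t, 0 ≤ t → z t = ∫ s in (0 : ℝ)..t, G (z s)) {t : ℝ}
    (ht : 0 < t) : y t < z t := by
  have hcG : ∀ s, c ≤ G s := fun s => (hcF s).trans (hFG s)
  have hypos : 0 < y t := lt_of_lt_of_le (by positivity) (mul_le_solution hF hcF hy hyF ht.le)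
  rw [← (travelTime_strictMono hG hc hcG).lt_iff_lt, travelTime_solution hG hc hcG hz hzG ht.le]
  refine lt_of_lt_of_eq ?_ (travelTime_solution hF hc hcF hy hyF ht.le)
  have hm : 0 < min (y t) (r / 2) := lt_min hypos (by linarith)
  refine intervalIntegral.integral_lt_integral_of_continuousOn_of_le_of_exists_lt hypos
    (continuous_inv_of_pos hG hc hcG).continuousOn (continuous_inv_of_pos hF hc hcF).continuousOn
    (fun s _ => inv_anti₀ (hc.trans_le (hcF s)) (hFG s))
    ⟨min (y t) (r / 2), ⟨hm.le, min_le_left _ _⟩, inv_strictAnti₀ (hc.trans_le (hcF _))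
      (hlt _ hm ((min_le_right _ _).trans_lt (by linarith)))⟩

theorem tendsto_travelTime {G : ℕ → ℝ → ℝ} (hG : ∀ j, Continuous (G j)) (hc : 0 < c)
    (hcG : ∀ j s, c ≤ G j s) (hcF : ∀ s, c ≤ F s)
    (hlim : ∀ s, 0 < s → Tendsto (fun j => G j s) atTop (𝓝 (F s))) {s : ℝ} (hs : 0 ≤ s) :
    Tendsto (fun j => travelTime (G j) s) atTop (𝓝 (travelTime F s)) := by
  refine intervalIntegral.tendsto_integral_filter_of_dominated_convergence (fun _ => c⁻¹)
    (Eventually.of_forall fun j => (continuous_inv_of_pos (hG j) hc (hcG j)).aestronglyMeasurable)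
    (Eventually.of_forall fun j => Eventually.of_forall fun r _ => ?_)
    intervalIntegrable_const (Eventually.of_forall fun r hr => ?_)
  · rw [Real.norm_of_nonneg (inv_nonneg.2 (hc.le.trans (hcG j r)))]
    exact inv_anti₀ hc (hcG j r)
  · rw [uIoc_of_le hs] at hr
    exact (hlim r hr.1).inv₀ (hc.trans_le (hcF r)).ne'

/-- Solutions depend continuously on a right-hand side that is bounded away from `0`. -/
theorem tendsto_solution {G : ℕ → ℝ → ℝ} (hG : ∀ j, Continuous (G j)) (hc : 0 < c)
    (hcG : ∀ j s, c ≤ G j s) (hF : Continuous F) (hcF : ∀ s, c ≤ F s)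
    (hlim : ∀ s, 0 < s → Tendsto (fun j => G j s) atTop (𝓝 (F s))) {y : ℕ → ℝ → ℝ} {z : ℝ → ℝ}
    (hy : ∀ j, Continuous (y j)) (hyG : ∀ j t, 0 ≤ t → y j t = ∫ s in (0 : ℝ)..t, G j (y j s))
    (hz : Continuous z) (hzF : ∀ t, 0 ≤ t → z t = ∫ s in (0 : ℝ)..t, F (z s)) {t : ℝ}
    (ht : 0 ≤ t) : Tendsto (fun j => y j t) atTop (𝓝 (z t)) := by
  have hz0 : 0 ≤ z t := le_trans (by positivity) (mul_le_solution hF hcF hz hzF ht)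
  refine tendsto_order.2 ⟨fun s hs => ?_, fun s hs => ?_⟩
  · rcases lt_or_ge s 0 with h0 | h0
    · exact Eventually.of_forall fun j => h0.trans_le
        (le_trans (by positivity) (mul_le_solution (hG j) (hcG j) (hy j) (hyG j) ht))
    · have h1 : travelTime F s < t := by
        rw [← travelTime_solution hF hc hcF hz hzF ht]
        exact travelTime_strictMono hF hc hcF hs
      filter_upwards [(tendsto_travelTime hG hc hcG hcF hlim h0).eventually_lt_const h1] with j hj
      rwa [← (travelTime_strictMono (hG j) hc (hcG j)).lt_iff_lt,
        travelTime_solution (hG j) hc (hcG j) (hy j) (hyG j) ht]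
  · have h1 : t < travelTime F s := by
      rw [← travelTime_solution hF hc hcF hz hzF ht]
      exact travelTime_strictMono hF hc hcF hs
    filter_upwards
      [(tendsto_travelTime hG hc hcG hcF hlim (hz0.trans hs.le)).eventually_const_lt h1] with j hj
    rwa [← (travelTime_strictMono (hG j) hc (hcG j)).lt_iff_lt,
      travelTime_solution (hG j) hc (hcG j) (hy j) (hyG j) ht]

end ODE

/-! ### Propagation of sublevel sets at a prescribed speed -/

section Barrier

theorem hasDerivAt_posPart_sq (s : ℝ) : HasDerivAt (fun s : ℝ => max s 0 ^ 2) (2 * max s 0) s := by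
  rcases lt_trichotomy s 0 with hs | rfl | hs
  · rw [max_eq_right hs.le, mul_zero]
    refine (hasDerivAt_const s (0 : ℝ)).congr_of_eventuallyEq ?_
    filter_upwards [Iio_mem_nhds hs] with r hr
    simp [max_eq_right (le_of_lt (mem_Iio.1 hr))]
  · rw [hasDerivAt_iff_isLittleO]
    simp only [max_self, sub_zero, mul_zero, smul_zero, ne_eq, OfNat.ofNat_ne_zero,
      not_false_eq_true, zero_pow]
    refine Asymptotics.IsBigO.trans_isLittleO (g := fun s : ℝ => s ^ 2) ?_ ?_
    · refine Asymptotics.IsBigO.of_bound 1 (Eventually.of_forall fun r => ?_)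
      rw [one_mul, norm_pow, norm_pow]
      gcongr
      rw [Real.norm_eq_abs, Real.norm_eq_abs, abs_of_nonneg (le_max_right r 0)]
      exact max_le (le_abs_self r) (abs_nonneg r)
    · simpa using Asymptotics.isLittleO_pow_pow (𝕜 := ℝ) (show 1 < 2 by norm_num)
  · rw [max_eq_left hs.le]
    have : HasDerivAt (fun s : ℝ => s ^ 2) (2 * s) s := by simpa using hasDerivAt_pow 2 s
    refine this.congr_of_eventuallyEq ?_
    filter_upwards [Ioi_mem_nhds hs] with r hr
    simp [max_eq_left (le_of_lt (mem_Ioi.1 hr))]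

theorem contDiff_posPart_sq : ContDiff ℝ 1 (fun s : ℝ => max s 0 ^ 2) := by
  rw [contDiff_one_iff_deriv]
  refine ⟨fun s => (hasDerivAt_posPart_sq s).differentiableAt, ?_⟩
  rw [show deriv (fun s : ℝ => max s 0 ^ 2) = fun s => 2 * max s 0 from
    funext fun s => (hasDerivAt_posPart_sq s).deriv]
  fun_prop

variable {V : Type*} [NormedAddCommGroup V] [InnerProductSpace ℝ V]

/-- `w` is, at the points with `w < k` and at the times in `(a, b)`, a viscosity supersolution of
`w_t + c(t) |∇w| = 0`: the sublevel sets of `w` below `k` expand with velocity at most `c`. -/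
def SpeedLE (w : V → ℝ → ℝ) (k : ℝ) (c : ℝ → ℝ) (a b : ℝ) : Prop :=
  ∀ φ : V × ℝ → ℝ, ContDiff ℝ 1 φ → ∀ x, ∀ t ∈ Ioo a b, w x t < k →
    IsLocalMin (fun p : V × ℝ => w p.1 p.2 - φ p) (x, t) →
    0 ≤ deriv (fun s => φ (x, s)) t + c t * ‖fderiv ℝ (fun y => φ (y, t)) x‖

/-- Barrier principle: `w` stays above `k` on `{ψ ≤ 0}`, for a function `ψ` whose set `{ψ > 0}`
moves at least as fast as the sublevel sets of `w`. The test function is `k` minus a small linear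
function of time, minus large multiples of `(ψ⁺)²` and of `((t - t₁)⁺)²`; these penalties keep the
minimum away from the lateral boundary and from the final time. -/
theorem le_of_barrier [ProperSpace V] {w : V → ℝ → ℝ}
    (hw : ContinuousOn (Function.uncurry w) (univ ×ˢ Ici 0))
    {k a b : ℝ} {c : ℝ → ℝ} (ha : 0 ≤ a) (hs : SpeedLE w k c a b) {ψ : V × ℝ → ℝ}
    (hψ : ContDiff ℝ 1 ψ)
    (hψc : ∀ x, ∀ t ∈ Ioo a b, 0 < ψ (x, t) →
      c t * ‖fderiv ℝ (fun y => ψ (y, t)) x‖ ≤ deriv (fun s => ψ (x, s)) t)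
    {m R : ℝ} (hm : 0 < m) {x₀ : V}
    (hini : ∀ x ∈ Metric.closedBall x₀ R, m ≤ ψ (x, a) ∨ k ≤ w x a)
    (hlat : ∀ x ∈ Metric.sphere x₀ R, ∀ t ∈ Icc a b, m ≤ ψ (x, t))
    {x₁ : V} {t₁ : ℝ} (hx₁ : x₁ ∈ Metric.closedBall x₀ R) (ht₁ : t₁ ∈ Ico a b)
    (hψ₁ : ψ (x₁, t₁) ≤ 0) : k ≤ w x₁ t₁ := by
  by_contra hlt
  rw [not_le] at hlt
  have hab : a < b := ht₁.1.trans_lt ht₁.2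
  set K : Set (V × ℝ) := Metric.closedBall x₀ R ×ˢ Icc a b with hK
  have hKc : IsCompact K := (isCompact_closedBall _ _).prod isCompact_Icc
  have hwK : ContinuousOn (Function.uncurry w) K :=
    hw.mono (prod_mono (subset_univ _) fun t ht => ha.trans ht.1)
  obtain ⟨L, hL⟩ := hKc.bddBelow_image hwK
  set N : ℝ := max (k - L) 0 with hN
  have hN0 : 0 ≤ N := le_max_right _ _
  have hNw : ∀ p ∈ K, k - N ≤ w p.1 p.2 := fun p hp => by
    have h1 : L ≤ w p.1 p.2 := hL (mem_image_of_mem _ hp)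
    linarith [le_max_left (k - L) 0]
  set ε : ℝ := (k - w x₁ t₁) / (2 * (b - a)) with hε
  have hε0 : 0 < ε := div_pos (by linarith) (by linarith)
  set A : ℝ := N / m ^ 2 with hA
  set B : ℝ := N / (b - t₁) ^ 2 with hB
  have hA0 : 0 ≤ A := by positivity
  have hB0 : 0 ≤ B := by positivity
  have hAm : A * m ^ 2 = N := by rw [hA]; field_simp
  have hBb : B * (b - t₁) ^ 2 = N := by
    have : b - t₁ ≠ 0 := (sub_pos.2 ht₁.2).ne'
    rw [hB]; field_simp
  set φ : V × ℝ → ℝ := fun p =>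
    k - ε * (p.2 - a) - A * max (ψ p) 0 ^ 2 - B * max (p.2 - t₁) 0 ^ 2 with hφ
  have hφd : ContDiff ℝ 1 φ := by
    have h1 : ContDiff ℝ 1 fun p : V × ℝ => max (ψ p) 0 ^ 2 := contDiff_posPart_sq.comp hψ
    have h2 : ContDiff ℝ 1 fun p : V × ℝ => max (p.2 - t₁) 0 ^ 2 :=
      contDiff_posPart_sq.comp (contDiff_snd.sub contDiff_const)
    exact ((contDiff_const.sub (contDiff_const.mul (contDiff_snd.sub contDiff_const))).sub
      (contDiff_const.mul h1)).sub (contDiff_const.mul h2)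
  obtain ⟨p, hpK, hpmin⟩ := hKc.exists_isMinOn (f := fun p => w p.1 p.2 - φ p)
    ⟨(x₁, t₁), hx₁, ht₁.1, ht₁.2.le⟩ (hwK.sub hφd.continuous.continuousOn)
  obtain ⟨x, t⟩ := p
  obtain ⟨hx, hta, htb⟩ := hpK
  simp only at hx hta htb
  have hval : w x t - φ (x, t) < 0 := by
    have h1 : w x t - φ (x, t) ≤ w x₁ t₁ - φ (x₁, t₁) :=
      hpmin (show (x₁, t₁) ∈ K from ⟨hx₁, ht₁.1, ht₁.2.le⟩)
    have h2 : φ (x₁, t₁) = k - ε * (t₁ - a) := by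
      simp [hφ, max_eq_right hψ₁]
    have h3 : ε * (t₁ - a) ≤ ε * (b - a) := by gcongr; exact ht₁.2.le
    have h4 : ε * (b - a) = (k - w x₁ t₁) / 2 := by
      have : b - a ≠ 0 := (sub_pos.2 hab).ne'
      rw [hε]; field_simp
    linarith
  have hwN : k - N ≤ w x t := hNw (x, t) ⟨hx, hta, htb⟩
  have he : 0 ≤ ε * (t - a) := mul_nonneg hε0.le (sub_nonneg.2 hta)
  have hq1 : 0 ≤ A * max (ψ (x, t)) 0 ^ 2 := by positivity
  have hq2 : 0 ≤ B * max (t - t₁) 0 ^ 2 := by positivity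
  have hφv : φ (x, t) = k - ε * (t - a) - A * max (ψ (x, t)) 0 ^ 2 - B * max (t - t₁) 0 ^ 2 := rfl
  have hψm : ψ (x, t) < m := by
    by_contra hge
    rw [not_lt] at hge
    have : A * m ^ 2 ≤ A * max (ψ (x, t)) 0 ^ 2 := by gcongr; exact hge.trans (le_max_left _ _)
    linarith
  have hta' : a < t := by
    refine lt_of_le_of_ne hta fun h => ?_
    subst h
    rcases hini x hx with h1 | h1
    · exact absurd h1 (not_le.2 hψm)
    · linarith
  have htb' : t < b := by
    refine lt_of_le_of_ne htb fun h => ?_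
    subst h
    rw [max_eq_left (sub_nonneg.2 ht₁.2.le)] at hφv hq2
    linarith
  have hx' : x ∈ Metric.ball x₀ R := by
    rw [Metric.mem_ball]
    exact lt_of_le_of_ne hx fun h => absurd (hlat x h t ⟨hta, htb⟩) (not_le.2 hψm)
  have hmin : IsLocalMin (fun p : V × ℝ => w p.1 p.2 - φ p) (x, t) :=
    hpmin.isLocalMin (prod_mem_nhds (Filter.mem_of_superset (Metric.isOpen_ball.mem_nhds hx')
      Metric.ball_subset_closedBall) (Icc_mem_nhds hta' htb'))
  have htest := hs φ hφd x t ⟨hta', htb'⟩ (by linarith) hmin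
  have hψdiff : DifferentiableAt ℝ ψ (x, t) := (hψ.differentiable one_ne_zero) _
  have hψt : HasDerivAt (fun s => ψ (x, s)) (deriv (fun s => ψ (x, s)) t) t :=
    (hψdiff.comp t ((differentiableAt_const x).prodMk differentiableAt_id)).hasDerivAt
  have hψx : HasFDerivAt (fun y => ψ (y, t)) (fderiv ℝ (fun y => ψ (y, t)) x) x :=
    (hψdiff.comp x (differentiableAt_id.prodMk (differentiableAt_const t))).hasFDerivAt
  have hd1 : HasDerivAt (fun s => φ (x, s)) (-(ε * 1)
      - A * (2 * max (ψ (x, t)) 0 * deriv (fun s => ψ (x, s)) t)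
      - B * (2 * max (t - t₁) 0 * 1)) t := by
    have h1 : HasDerivAt (fun s => max (ψ (x, s)) 0 ^ 2)
        (2 * max (ψ (x, t)) 0 * deriv (fun s => ψ (x, s)) t) t :=
      HasDerivAt.comp (h₂ := fun s : ℝ => max s 0 ^ 2) t (hasDerivAt_posPart_sq (ψ (x, t))) hψt
    have h2 : HasDerivAt (fun s : ℝ => max (s - t₁) 0 ^ 2) (2 * max (t - t₁) 0 * 1) t :=
      HasDerivAt.comp (h₂ := fun s : ℝ => max s 0 ^ 2) t (hasDerivAt_posPart_sq (t - t₁))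
        ((hasDerivAt_id t).sub_const t₁)
    exact (((((hasDerivAt_id t).sub_const a).const_mul ε).const_sub k).sub (h1.const_mul A)).sub
      (h2.const_mul B)
  have hd2 : HasFDerivAt (fun y => φ (y, t))
      (-(A • (2 * max (ψ (x, t)) 0) • fderiv ℝ (fun y => ψ (y, t)) x)) x := by
    have h1 : HasFDerivAt (fun y => max (ψ (y, t)) 0 ^ 2)
        ((2 * max (ψ (x, t)) 0) • fderiv ℝ (fun y => ψ (y, t)) x) x :=
      HasDerivAt.comp_hasFDerivAt (h₂ := fun s : ℝ => max s 0 ^ 2) x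
        (hasDerivAt_posPart_sq (ψ (x, t))) hψx
    exact ((h1.const_mul A).const_sub (k - ε * (t - a))).sub_const (B * max (t - t₁) 0 ^ 2)
  rw [hd1.deriv, hd2.fderiv, norm_neg, norm_smul, norm_smul, Real.norm_of_nonneg hA0,
    Real.norm_of_nonneg (show 0 ≤ 2 * max (ψ (x, t)) 0 by positivity)] at htest
  have hq3 : 0 ≤ B * (2 * max (t - t₁) 0 * 1) := by positivity
  rcases le_or_gt (ψ (x, t)) 0 with h0 | h0
  · rw [max_eq_right h0] at htest
    simp only [mul_zero, zero_mul, sub_zero, add_zero] at htest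
    linarith
  · have h1 := hψc x t ⟨hta', htb'⟩ h0
    have h2 : 0 ≤ A * (2 * max (ψ (x, t)) 0) := by positivity
    nlinarith [mul_le_mul_of_nonneg_left h1 h2]

theorem SpeedLE.mono {w : V → ℝ → ℝ} {k k' a b : ℝ} {c : ℝ → ℝ} (hs : SpeedLE w k c a b)
    (hk : k' ≤ k) : SpeedLE w k' c a b :=
  fun φ hφ x t ht hwx hmin => hs φ hφ x t ht (hwx.trans_le hk) hmin

theorem contDiff_primitive {c : ℝ → ℝ} (hc : Continuous c) (a : ℝ) :
    ContDiff ℝ 1 fun t => ∫ s in a..t, c s := by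
  rw [contDiff_one_iff_deriv]
  have h : ∀ t, HasDerivAt (fun t => ∫ s in a..t, c s) (c t) t := fun t =>
    (hc.integral_hasStrictDerivAt a t).hasDerivAt
  refine ⟨fun t => (h t).differentiableAt, ?_⟩
  rwa [show deriv (fun t => ∫ s in a..t, c s) = c from funext fun t => (h t).deriv]

/-- If the sublevel sets expand with velocity at most `c ≥ 0`, then a point of `{w(·, t₁) < k}` has
distance at most `∫ₐ^{t₁} c` to `{w(·, a) < k}`. The barrier is built on the smooth substitute
`√(|x - x₁|² + κ²) - κ` for the distance to `x₁`, whose gradient has norm at most `1`. -/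
theorem infEDist_le_of_speedLE [ProperSpace V] {w : V → ℝ → ℝ}
    (hw : ContinuousOn (Function.uncurry w) (univ ×ˢ Ici 0)) {k a b : ℝ} {c : ℝ → ℝ} (ha : 0 ≤ a)
    (hc : Continuous c) (hc0 : ∀ t ∈ Icc a b, 0 ≤ c t) (hs : SpeedLE w k c a b) {x₁ : V} {t₁ : ℝ}
    (ht₁ : t₁ ∈ Ico a b) (hx₁ : w x₁ t₁ < k) :
    Metric.infEDist x₁ {x | w x a < k} ≤ ENNReal.ofReal (∫ s in a..t₁, c s) := by
  set C : ℝ → ℝ := fun t => ∫ s in a..t, c s with hC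
  have hCd : ∀ t, HasDerivAt C (c t) t := fun t => (hc.integral_hasStrictDerivAt a t).hasDerivAt
  have hC0 : ∀ t ∈ Icc a b, 0 ≤ C t := fun t ht =>
    intervalIntegral.integral_nonneg ht.1 fun s hs => hc0 s ⟨hs.1, hs.2.trans ht.2⟩
  have hC1 : 0 ≤ C t₁ := hC0 t₁ ⟨ht₁.1, ht₁.2.le⟩
  refine le_of_forall_pos_le_add fun κ' hκ' => ?_
  obtain ⟨κ, hκ, hκκ'⟩ : ∃ κ : ℝ, 0 < κ ∧ ENNReal.ofReal (2 * κ) ≤ κ' := by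
    rcases eq_or_ne κ' ⊤ with rfl | hne
    · exact ⟨1, one_pos, le_top⟩
    · refine ⟨κ'.toReal / 2, half_pos (ENNReal.toReal_pos hκ'.ne' hne), ?_⟩
      rw [mul_div_cancel₀ _ two_ne_zero, ENNReal.ofReal_toReal hne]
  refine le_trans ?_ (add_le_add_right hκκ' _)
  rw [← ENNReal.ofReal_add hC1 (by positivity)]
  by_contra hfar
  rw [not_le] at hfar
  set R : ℝ := C t₁ + 2 * κ with hR
  have hsq : ∀ x : V, 0 < ‖x - x₁‖ ^ 2 + κ ^ 2 := fun x => by positivity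
  refine absurd hx₁ (not_lt.2 ?_)
  refine le_of_barrier hw ha hs (m := κ) (R := R) (x₀ := x₁)
    (ψ := fun p => √(‖p.1 - x₁‖ ^ 2 + κ ^ 2) - κ + (C p.2 - C t₁)) ?_ ?_ hκ ?_ ?_
    (Metric.mem_closedBall_self (by positivity)) ht₁ ?_
  · refine (ContDiff.sub (ContDiff.sqrt ?_ fun p => (hsq p.1).ne') contDiff_const).add
      (((contDiff_primitive hc a).comp contDiff_snd).sub contDiff_const)
    exact ((contDiff_fst.sub contDiff_const).norm_sq ℝ).add contDiff_const
  · intro x t ht _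
    have h1 : HasDerivAt (fun s => √(‖x - x₁‖ ^ 2 + κ ^ 2) - κ + (C s - C t₁)) (c t) t :=
      ((hCd t).sub_const _).const_add _
    have h2 : HasFDerivAt (fun y : V => ‖y - x₁‖ ^ 2 + κ ^ 2)
        (2 • (innerSL ℝ (x - x₁)).comp (ContinuousLinearMap.id ℝ V)) x :=
      (((hasFDerivAt_id x).sub_const x₁).norm_sq).add_const (κ ^ 2)
    have h3 := ((h2.sqrt (hsq x).ne').sub_const κ).add_const (C t - C t₁)
    rw [h1.deriv, h3.fderiv]
    refine mul_le_of_le_one_right (hc0 t ⟨ht.1.le, ht.2.le⟩) ?_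
    have hle : ‖x - x₁‖ ≤ √(‖x - x₁‖ ^ 2 + κ ^ 2) := Real.le_sqrt_of_sq_le (by nlinarith)
    have hpos : 0 < √(‖x - x₁‖ ^ 2 + κ ^ 2) := Real.sqrt_pos.2 (hsq x)
    rw [norm_smul, ContinuousLinearMap.comp_id, ← Nat.cast_smul_eq_nsmul ℝ, norm_smul,
      innerSL_apply_norm, Real.norm_of_nonneg (by positivity)]
    rw [div_mul_eq_mul_div, one_mul, div_le_one (by positivity)]
    simpa using hle
  · intro x hx
    right
    by_contra hlt
    rw [not_le] at hlt
    refine absurd hfar (not_lt.2 ((Metric.infEDist_le_edist_of_mem (show x ∈ {x | w x a < k} from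
      hlt)).trans ?_))
    rw [edist_comm, edist_dist]
    exact ENNReal.ofReal_le_ofReal hx
  · intro x hx t ht
    have h1 : R ≤ √(‖x - x₁‖ ^ 2 + κ ^ 2) := by
      rw [← mem_sphere_iff_norm.1 hx]
      exact Real.le_sqrt_of_sq_le (by nlinarith)
    have h2 := hC0 t ht
    simp only
    linarith
  · simp [Real.sqrt_sq hκ.le]

/-- If the sublevel sets shrink with velocity at least `c ≥ 0`, then the closed ball of radius
`∫ₐ^{t₁} c` about a point of `{w(·, t₁) < k}` lies in `{w(·, a) < k}`. The barrier vanishes on the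
balls of radius `r + ∫ₐᵗ c` about a point `y` and is built on `|x - y|²`. -/
theorem lt_of_speedLE_neg [ProperSpace V] {w : V → ℝ → ℝ}
    (hw : ContinuousOn (Function.uncurry w) (univ ×ˢ Ici 0)) {k a b : ℝ} {c : ℝ → ℝ} (ha : 0 ≤ a)
    (hc : Continuous c) (hc0 : ∀ t ∈ Icc a b, 0 ≤ c t) (hs : SpeedLE w k (fun t => -c t) a b)
    {x₁ y : V} {t₁ : ℝ} (ht₁ : t₁ ∈ Ico a b) (hx₁ : w x₁ t₁ < k)
    (hy : dist x₁ y ≤ ∫ s in a..t₁, c s) : w y a < k := by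
  set C : ℝ → ℝ := fun t => ∫ s in a..t, c s with hC
  have hab : a < b := ht₁.1.trans_lt ht₁.2
  have hCd : ∀ t, HasDerivAt C (c t) t := fun t => (hc.integral_hasStrictDerivAt a t).hasDerivAt
  have hint : ∀ r t, IntervalIntegrable c volume r t := fun r t => hc.intervalIntegrable r t
  have hC0 : ∀ t ∈ Icc a b, 0 ≤ C t := fun t ht =>
    intervalIntegral.integral_nonneg ht.1 fun s hs => hc0 s ⟨hs.1, hs.2.trans ht.2⟩
  have hCmono : ∀ t ∈ Icc a b, C t ≤ C b := fun t ht => by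
    have h1 : C b - C t = ∫ s in t..b, c s :=
      intervalIntegral.integral_interval_sub_left (hint _ _) (hint _ _)
    have h2 : 0 ≤ ∫ s in t..b, c s :=
      intervalIntegral.integral_nonneg ht.2 fun s hs => hc0 s ⟨ht.1.trans hs.1, hs.2⟩
    linarith
  by_contra hge
  rw [not_lt] at hge
  obtain ⟨k', hk1, hk2⟩ := exists_between hx₁
  have hwy : ContinuousAt (fun x => w x a) y := by
    have h1 : ContinuousOn (fun x => w x a) univ :=
      hw.comp (f := fun x : V => (x, a)) (by fun_prop) fun x _ => ⟨mem_univ _, ha⟩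
    exact h1.continuousAt univ_mem
  obtain ⟨r, hr, hball⟩ := Metric.eventually_nhds_iff_ball.1
    (hwy.eventually_const_lt (hk2.trans_le hge))
  set ρ : ℝ := r / 2 with hρ
  have hρ0 : 0 < ρ := half_pos hr
  have hCb : 0 ≤ C b := hC0 b ⟨hab.le, le_rfl⟩
  refine absurd hk1 (not_lt.2 ?_)
  refine le_of_barrier hw ha (hs.mono hk2.le) (m := 3 * ρ ^ 2)
    (R := 2 * ρ + C b) (x₀ := y)
    (ψ := fun p => ‖p.1 - y‖ ^ 2 - (ρ + C p.2) ^ 2) ?_ ?_ (by positivity) ?_ ?_ ?_ ht₁ ?_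
  · exact ((contDiff_fst.sub contDiff_const).norm_sq ℝ).sub
      ((contDiff_const.add ((contDiff_primitive hc a).comp contDiff_snd)).pow 2)
  · intro x t ht hpos
    have h1 : HasDerivAt (fun s => ‖x - y‖ ^ 2 - (ρ + C s) ^ 2)
        (-(2 * (ρ + C t) * c t)) t := by
      have := (((hCd t).const_add ρ).pow 2).const_sub (‖x - y‖ ^ 2)
      simpa using this
    have h2 : HasFDerivAt (fun x : V => ‖x - y‖ ^ 2 - (ρ + C t) ^ 2)
        (2 • (innerSL ℝ (x - y)).comp (ContinuousLinearMap.id ℝ V)) x :=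
      (((hasFDerivAt_id x).sub_const y).norm_sq).sub_const _
    rw [h1.deriv, h2.fderiv, ContinuousLinearMap.comp_id, ← Nat.cast_smul_eq_nsmul ℝ, norm_smul,
      innerSL_apply_norm]
    have h3 : ρ + C t ≤ ‖x - y‖ := by
      refine le_of_lt (lt_of_pow_lt_pow_left₀ 2 (norm_nonneg _) ?_)
      simp only at hpos
      linarith
    have h4 := mul_le_mul_of_nonneg_left h3 (hc0 t ⟨ht.1.le, ht.2.le⟩)
    simp only [Nat.cast_ofNat, Real.norm_ofNat]
    nlinarith
  · intro x _
    have hCa : C a = 0 := by simp [hC]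
    rcases lt_or_ge (dist x y) r with h | h
    · exact Or.inr (hball x h).le
    · left
      rw [dist_eq_norm] at h
      simp only [hCa, add_zero]
      nlinarith
  · intro x hx t ht
    rw [mem_sphere_iff_norm] at hx
    simp only [hx]
    have h1 := hCmono t ht
    have h2 := hC0 t ht
    nlinarith
  · rw [Metric.mem_closedBall]
    exact hy.trans ((hCmono t₁ ⟨ht₁.1, ht₁.2.le⟩).trans (by linarith))
  · rw [dist_eq_norm] at hy
    have h1 : 0 ≤ ‖x₁ - y‖ := norm_nonneg _
    have h2 : ‖x₁ - y‖ ≤ C t₁ := hy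
    simp only
    nlinarith

end Barrier

/-! ### Velocities and the duality `u ↦ -u` -/

section Speed

/-- The properties of a velocity which matter for masses in `[0, Q]`. In contrast to `IsVelocity`
they are invariant under the duality `dualSpeed`. -/
structure IsSpeed (f : ℝ → ℝ≥0 → ℝ) (Q : ℝ≥0) : Prop where
  bounded : ∃ M : ℝ, ∀ r q, |f r q| ≤ M
  continuous : Continuous (Function.uncurry f)
  mono : ∀ r₁ r₂ q₁ q₂, r₁ ≤ r₂ → q₁ ≤ q₂ → f r₁ q₁ ≤ f r₂ q₂
  strict_mono_mass : ∀ r q₁ q₂, q₁ < q₂ → q₂ ≤ Q → f r q₁ < f r q₂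

/-- The velocity governing `-u` when `f` governs `u` and `Q` is the total mass: complements of
sublevel sets are sublevel sets of `-u`, and the direction of motion is reversed. -/
def dualSpeed (f : ℝ → ℝ≥0 → ℝ) (Q : ℝ≥0) : ℝ → ℝ≥0 → ℝ := fun r q => -f (-r) (Q - q)

theorem IsVelocity.isSpeed {f : ℝ → ℝ≥0 → ℝ} (hf : IsVelocity f) (Q : ℝ≥0) : IsSpeed f Q where
  bounded := hf.bounded
  continuous := hf.continuous
  mono := by
    intro r₁ r₂ q₁ q₂ hr hq
    have h1 : f r₁ q₁ ≤ f r₂ q₁ := by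
      rcases hr.eq_or_lt with rfl | h
      exacts [le_rfl, hf.mono_level _ _ _ h]
    have h2 : f r₂ q₁ ≤ f r₂ q₂ := by
      rcases hq.eq_or_lt with rfl | h
      exacts [le_rfl, (hf.strict_mono_mass _ _ _ h).le]
    exact h1.trans h2
  strict_mono_mass := fun r q₁ q₂ h _ => hf.strict_mono_mass r q₁ q₂ h

variable {f : ℝ → ℝ≥0 → ℝ} {Q : ℝ≥0}

theorem IsSpeed.dual (hf : IsSpeed f Q) : IsSpeed (dualSpeed f Q) Q where
  bounded := by
    obtain ⟨M, hM⟩ := hf.bounded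
    exact ⟨M, fun r q => by rw [dualSpeed, abs_neg]; exact hM _ _⟩
  continuous := by
    have : Continuous fun p : ℝ × ℝ≥0 => (-p.1, Q - p.2) :=
      continuous_fst.neg.prodMk (continuous_const.sub continuous_snd)
    exact (hf.continuous.comp this).neg
  mono := fun r₁ r₂ q₁ q₂ hr hq =>
    neg_le_neg (hf.mono _ _ _ _ (neg_le_neg hr) (tsub_le_tsub_left hq Q))
  strict_mono_mass := fun r q₁ q₂ hq hQ =>
    neg_lt_neg (hf.strict_mono_mass _ _ _ (tsub_lt_tsub_left_of_le hQ hq) tsub_le_self)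

theorem IsSpeed.continuous_comp (hf : IsSpeed f Q) {X : Type*} [TopologicalSpace X] {q : X → ℝ≥0}
    (hq : Continuous q) (r : ℝ) : Continuous fun x => f r (q x) :=
  hf.continuous.comp (continuous_const.prodMk hq)

theorem IsSpeed.tendsto (hf : IsSpeed f Q) {ι : Type*} {L : Filter ι} {r : ι → ℝ} {q : ι → ℝ≥0}
    {r₀ : ℝ} {q₀ : ℝ≥0} (hr : Tendsto r L (𝓝 r₀)) (hq : Tendsto q L (𝓝 q₀)) :
    Tendsto (fun i => f (r i) (q i)) L (𝓝 (f r₀ q₀)) :=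
  (hf.continuous.tendsto (r₀, q₀)).comp (hr.prodMk_nhds hq)

variable {n : ℕ} {Θ : EuclideanSpace ℝ (Fin n) → ℝ}

theorem dualSpeed_mass_compl (hΘ : IsDensity Θ) {A : Set (EuclideanSpace ℝ (Fin n))}
    (hA : MeasurableSet A) (r : ℝ) :
    dualSpeed f (mass Θ univ) (-r) (mass Θ Aᶜ) = -f r (mass Θ A) := by
  have := mass_compl hΘ hA.compl
  rw [compl_compl] at this
  rw [dualSpeed, neg_neg, ← this]

theorem speed_mass_compl (hΘ : IsDensity Θ) {A : Set (EuclideanSpace ℝ (Fin n))}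
    (hA : MeasurableSet A) (r : ℝ) :
    f r (mass Θ Aᶜ) = -dualSpeed f (mass Θ univ) (-r) (mass Θ A) := by
  rw [dualSpeed, neg_neg, neg_neg, mass_compl hΘ hA]

theorem dualSpeed_dualSpeed_mass (hΘ : IsDensity Θ) (A : Set (EuclideanSpace ℝ (Fin n))) (r : ℝ) :
    dualSpeed (dualSpeed f (mass Θ univ)) (mass Θ univ) r (mass Θ A) = f r (mass Θ A) := by
  rw [dualSpeed, dualSpeed, neg_neg, neg_neg,
    tsub_tsub_cancel_of_le (mass_mono hΘ (subset_univ A))]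

end Speed

/-! ### Extremal evolutions of parallel sets -/

section Evolution

variable {n : ℕ} {f : ℝ → ℝ≥0 → ℝ} {Q : ℝ≥0} {Θ : EuclideanSpace ℝ (Fin n) → ℝ} {h : ℝ}
  {u₀ : EuclideanSpace ℝ (Fin n) → ℝ}

theorem IsEvolution.congr {W : ℝ → Set (EuclideanSpace ℝ (Fin n))} {δ η : ℝ → ℝ}
    (hδ : IsEvolution f Θ h W δ) (hη : ∀ t, 0 ≤ t → η t = δ t) : IsEvolution f Θ h W η where
  lipschitz := by
    obtain ⟨K, hK⟩ := hδ.lipschitz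
    refine ⟨K, fun s hs t ht => ?_⟩
    rw [hη s hs, hη t ht]
    exact hK hs ht
  initial := (hη 0 le_rfl).trans hδ.initial
  inclusion := by
    have h1 := hδ.inclusion
    rw [← restrict_Ioi_eq_restrict_Ici] at h1 ⊢
    filter_upwards [h1, ae_restrict_mem measurableSet_Ioi] with t ht htpos
    obtain ⟨v, hv, hv1, hv2⟩ := ht
    rw [hη t (le_of_lt htpos)]
    refine ⟨v, hv.congr_of_eventuallyEq ?_, hv1, hv2⟩
    filter_upwards [Ioi_mem_nhds htpos] with s hs using hη s (le_of_lt hs)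

theorem IsEvolution.neg {g : ℝ → ℝ≥0 → ℝ} {h' : ℝ} {W W' : ℝ → Set (EuclideanSpace ℝ (Fin n))}
    {δ : ℝ → ℝ} (hg : ∀ A : Set (EuclideanSpace ℝ (Fin n)), MeasurableSet A →
      g h' (mass Θ Aᶜ) = -f h (mass Θ A)) (hW : ∀ s, W' (-s) = (W s)ᶜ)
    (hδ : IsEvolution f Θ h W δ) : IsEvolution g Θ h' W' (fun t => -δ t) where
  lipschitz := by
    obtain ⟨K, hK⟩ := hδ.lipschitz
    refine ⟨K, fun s hs t ht => ?_⟩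
    rw [edist_neg_neg]
    exact hK hs ht
  initial := by simp [hδ.initial]
  inclusion := by
    filter_upwards [hδ.inclusion] with t ht
    obtain ⟨v, hv, hv1, hv2⟩ := ht
    refine ⟨-v, hv.neg, ?_, ?_⟩
    · rw [hW, interior_compl, hg _ isClosed_closure.measurableSet]
      exact neg_le_neg hv2
    · rw [hW, closure_compl, hg _ isOpen_interior.measurableSet]
      exact neg_le_neg hv1

theorem isEvolution_parD_iff (hΘ : IsDensity Θ) {δ : ℝ → ℝ} :
    IsEvolution f Θ h (parD u₀ h) δ ↔
      IsEvolution (dualSpeed f (mass Θ univ)) Θ (-h) (parE (-u₀) (-h)) (fun t => -δ t) := by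
  refine ⟨fun H => H.neg (fun A hA => dualSpeed_mass_compl hΘ hA h) fun s => parE_neg,
    fun H => ?_⟩
  have := H.neg (g := f) (h' := h) (W' := parD u₀ h)
    (fun A hA => speed_mass_compl hΘ hA h) fun s => by
      rw [← compl_compl (parD u₀ h (-s)), ← parE_neg, neg_neg]
  simpa using this

theorem monotone_speed_parE (hf : IsSpeed f Q) (hΘ : IsDensity Θ) :
    Monotone fun s => f h (mass Θ (parE u₀ h s)) := fun _ _ hst =>
  hf.mono _ _ _ _ le_rfl (mass_mono hΘ (monotone_parE hst))

theorem monotone_speed_parD (hf : IsSpeed f Q) (hΘ : IsDensity Θ) :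
    Monotone fun s => f h (mass Θ (parD u₀ h s)) := fun _ _ hst =>
  hf.mono _ _ _ _ le_rfl (mass_mono hΘ (monotone_parD hst))

theorem continuousWithinAt_speed_parE (hf : IsSpeed f Q) (hΘ : IsDensity Θ) (s : ℝ) :
    ContinuousWithinAt (fun s => f h (mass Θ (parE u₀ h s))) (Ici s) s := by
  refine hf.tendsto tendsto_const_nhds (tendsto_mass hΘ (fun _ => isClosed_parE.measurableSet)
    isClosed_parE.measurableSet (Eventually.of_forall fun x => ?_))
  rcases le_or_gt (sgnDist x (subE u₀ h)) s with hx | hx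
  · filter_upwards [self_mem_nhdsWithin] with r hr
    exact iff_of_true (monotone_parE hr hx) hx
  · have hcont : Tendsto (fun r : ℝ => (r : EReal)) (𝓝[≥] s) (𝓝 (s : EReal)) :=
      (continuous_coe_real_ereal.tendsto s).mono_left nhdsWithin_le_nhds
    filter_upwards [hcont.eventually_lt_const hx] with r hr
    exact iff_of_false (not_le.2 hr) (not_le.2 hx)

theorem continuousWithinAt_speed_parD (hf : IsSpeed f Q) (hΘ : IsDensity Θ) (s : ℝ) :
    ContinuousWithinAt (fun s => f h (mass Θ (parD u₀ h s))) (Iic s) s := by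
  refine hf.tendsto tendsto_const_nhds (tendsto_mass hΘ (fun _ => isOpen_parD.measurableSet)
    isOpen_parD.measurableSet (Eventually.of_forall fun x => ?_))
  rcases lt_or_ge (sgnDist x (subD u₀ h)) s with hx | hx
  · have hcont : Tendsto (fun r : ℝ => (r : EReal)) (𝓝[≤] s) (𝓝 (s : EReal)) :=
      (continuous_coe_real_ereal.tendsto s).mono_left nhdsWithin_le_nhds
    filter_upwards [hcont.eventually_const_lt hx] with r hr
    exact iff_of_true hr hx
  · filter_upwards [self_mem_nhdsWithin] with r hr
    exact iff_of_false (fun hxr => not_lt.2 hx (monotone_parD hr hxr)) (not_lt.2 hx)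

theorem IsEvolution.le_integral (hf : IsSpeed f Q) (hΘ : IsDensity Θ) {δ : ℝ → ℝ}
    (hδ : IsEvolution f Θ h (parE u₀ h) δ) {t : ℝ} (ht : 0 ≤ t) :
    δ t ≤ ∫ s in (0 : ℝ)..t, f h (mass Θ (parE u₀ h (δ (max s 0)))) := by
  obtain ⟨K, hK⟩ := hδ.lipschitz
  obtain ⟨M, hM⟩ := hf.bounded
  have hac : AbsolutelyContinuousOnInterval δ 0 t :=
    (hK.mono (by rw [uIcc_of_le ht]; exact Icc_subset_Ici_self)).absolutelyContinuousOnInterval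
  have h1 := hac.integral_deriv_eq_sub
  rw [hδ.initial, sub_zero] at h1
  have hcont : Continuous fun s => δ (max s 0) :=
    hK.continuousOn.comp_continuous (by fun_prop) fun s => le_max_right s 0
  rw [← h1]
  refine intervalIntegral.integral_mono_ae_restrict ht hac.intervalIntegrable_deriv
    (intervalIntegrable_comp (monotone_speed_parE hf hΘ) (fun _ => hM _ _) hcont.measurable _ _) ?_
  have h2 := ae_restrict_of_ae_restrict_of_subset
    (show Icc 0 t ⊆ Ici (0 : ℝ) from Icc_subset_Ici_self)
    hδ.inclusion
  filter_upwards [h2, ae_restrict_mem measurableSet_Icc] with s hs hs0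
  obtain ⟨v, hv, -, hv2⟩ := hs
  rw [isClosed_parE.closure_eq] at hv2
  simp only [max_eq_left hs0.1]
  rwa [hv.deriv]

theorem isEvolution_parE_of_eq_integral (hf : IsSpeed f Q) (hΘ : IsDensity Θ) {y : ℝ → ℝ}
    (hy : Continuous y)
    (hyF : ∀ t, 0 ≤ t → y t = ∫ s in (0 : ℝ)..t, f h (mass Θ (parE u₀ h (y s)))) :
    IsEvolution f Θ h (parE u₀ h) y := by
  obtain ⟨M, hM⟩ := hf.bounded
  refine ⟨⟨_, lipschitzOnWith_of_eq_integral (F := fun s => f h (mass Θ (parE u₀ h s)))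
    (monotone_speed_parE hf hΘ) (fun _ => hM _ _) hy hyF⟩, by simp [hyF 0 le_rfl], ?_⟩
  filter_upwards [ae_hasDerivAt_of_eq_integral (F := fun s => f h (mass Θ (parE u₀ h s)))
    (monotone_speed_parE hf hΘ) (fun _ => hM _ _) hy hyF] with t ht
  refine ⟨_, ht, hf.mono _ _ _ _ le_rfl (mass_mono hΘ interior_subset), ?_⟩
  rw [isClosed_parE.closure_eq]

theorem exists_maximal_evolution_parE (hf : IsSpeed f Q) (hΘ : IsDensity Θ)
    (u₀ : EuclideanSpace ℝ (Fin n) → ℝ) (h : ℝ) :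
    ∃ y : ℝ → ℝ, Continuous y ∧
      (∀ t, 0 ≤ t → y t = ∫ s in (0 : ℝ)..t, f h (mass Θ (parE u₀ h (y s)))) ∧
      IsMaximalEvolution f Θ h (parE u₀ h) y := by
  obtain ⟨M, hM⟩ := hf.bounded
  obtain ⟨y, hyc, hyF, -, hmax⟩ := exists_maximal_solution
    (F := fun s => f h (mass Θ (parE u₀ h s))) (monotone_speed_parE hf hΘ) (fun _ => hM _ _)
    (continuousWithinAt_speed_parE hf hΘ)
  refine ⟨y, hyc, hyF, isEvolution_parE_of_eq_integral hf hΘ hyc hyF, fun δ hδ t ht => ?_⟩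
  obtain ⟨K, hK⟩ := hδ.lipschitz
  have hcont : Continuous fun s => δ (max s 0) :=
    hK.continuousOn.comp_continuous (by fun_prop) fun s => le_max_right s 0
  have := hmax _ hcont.measurable (fun t ht => by
    rw [max_eq_left ht]; exact hδ.le_integral hf hΘ ht) t ht
  rwa [max_eq_left ht] at this

theorem deltaE_eq_of_isMaximalEvolution {y : ℝ → ℝ}
    (hy : IsMaximalEvolution f Θ h (parE u₀ h) y) {t : ℝ} (ht : 0 ≤ t) :
    deltaE f Θ u₀ t h = y t :=
  IsGreatest.csSup_eq ⟨⟨y, hy.1, rfl⟩, by rintro _ ⟨δ, hδ, rfl⟩; exact hy.2 δ hδ t ht⟩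

theorem isMaximalEvolution_deltaE (hf : IsSpeed f Q) (hΘ : IsDensity Θ) :
    IsMaximalEvolution f Θ h (parE u₀ h) (fun t => deltaE f Θ u₀ t h) := by
  obtain ⟨y, -, -, hy⟩ := exists_maximal_evolution_parE hf hΘ u₀ h
  refine ⟨hy.1.congr fun t ht => deltaE_eq_of_isMaximalEvolution hy ht, fun η hη t ht => ?_⟩
  exact (hy.2 η hη t ht).trans_eq (deltaE_eq_of_isMaximalEvolution hy ht).symm

theorem deltaD_eq_neg_deltaE (hΘ : IsDensity Θ) (t : ℝ) :
    deltaD f Θ u₀ t h = -deltaE (dualSpeed f (mass Θ univ)) Θ (-u₀) t (-h) := by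
  rw [deltaD, deltaE, Real.sInf_def]
  congr 2
  ext r
  simp only [Set.mem_neg, mem_ofPred_eq]
  constructor
  · rintro ⟨δ, hδ, hr⟩
    exact ⟨fun t => -δ t, (isEvolution_parD_iff hΘ).1 hδ, by simp [hr]⟩
  · rintro ⟨δ, hδ, hr⟩
    exact ⟨fun t => -δ t, (isEvolution_parD_iff hΘ).2 (by simpa using hδ), by simp [hr]⟩

theorem isMinimalEvolution_deltaD (hf : IsSpeed f (mass Θ univ)) (hΘ : IsDensity Θ) :
    IsMinimalEvolution f Θ h (parD u₀ h) (fun t => deltaD f Θ u₀ t h) := by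
  have hmax := isMaximalEvolution_deltaE hf.dual hΘ (u₀ := -u₀) (h := -h)
  refine ⟨(isEvolution_parD_iff hΘ).2 (hmax.1.congr fun t _ => ?_), fun η hη t ht => ?_⟩
  · rw [deltaD_eq_neg_deltaE hΘ, neg_neg]
  · refine (deltaD_eq_neg_deltaE hΘ t).trans_le ?_
    exact neg_le.1 (hmax.2 _ ((isEvolution_parD_iff hΘ).1 hη) t ht)

theorem exists_deltaE_eq (hf : IsSpeed f Q) (hΘ : IsDensity Θ)
    (u₀ : EuclideanSpace ℝ (Fin n) → ℝ) (h : ℝ) : ∃ y : ℝ → ℝ, Continuous y ∧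
      (∀ t, 0 ≤ t → y t = ∫ s in (0 : ℝ)..t, f h (mass Θ (parE u₀ h (y s)))) ∧
      ∀ t, 0 ≤ t → deltaE f Θ u₀ t h = y t := by
  obtain ⟨y, hyc, hyF, hy⟩ := exists_maximal_evolution_parE hf hΘ u₀ h
  exact ⟨y, hyc, hyF, fun t ht => deltaE_eq_of_isMaximalEvolution hy ht⟩

theorem exists_deltaD_eq (hf : IsSpeed f (mass Θ univ)) (hΘ : IsDensity Θ)
    (u₀ : EuclideanSpace ℝ (Fin n) → ℝ) (h : ℝ) : ∃ y : ℝ → ℝ, Continuous y ∧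
      (∀ t, 0 ≤ t → y t = ∫ s in (0 : ℝ)..t, f h (mass Θ (parD u₀ h (y s)))) ∧
      ∀ t, 0 ≤ t → deltaD f Θ u₀ t h = y t := by
  obtain ⟨y, hyc, hyF, hy⟩ := exists_deltaE_eq hf.dual hΘ (-u₀) (-h)
  refine ⟨fun t => -y t, hyc.neg, fun t ht => ?_, fun t ht => ?_⟩
  · simp only
    rw [hyF t ht, ← intervalIntegral.integral_neg]
    congr 1
    ext s
    have : parE (-u₀) (-h) (y s) = (parD u₀ h (-y s))ᶜ := by rw [← parE_neg, neg_neg]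
    rw [this, dualSpeed_mass_compl hΘ isOpen_parD.measurableSet, neg_neg]
  · rw [deltaD_eq_neg_deltaE hΘ, hy t ht]

end Evolution

/-! ### Fronts of viscosity solutions -/

section Front

variable {n : ℕ} {f : ℝ → ℝ≥0 → ℝ} {Q : ℝ≥0} {Θ : EuclideanSpace ℝ (Fin n) → ℝ}

/-- The supersolution property of `w` on `ℝⁿ × (0, ∞)` in the form in which it is applied: test
functions are `C¹` on the whole space-time, and the sizes of their derivatives are expressed through
`fderiv`. -/
def IsSuper (f : ℝ → ℝ≥0 → ℝ) (Θ : EuclideanSpace ℝ (Fin n) → ℝ)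
    (w : EuclideanSpace ℝ (Fin n) → ℝ → ℝ) : Prop :=
  ∀ φ : EuclideanSpace ℝ (Fin n) × ℝ → ℝ, ContDiff ℝ 1 φ → ∀ x t, 0 < t →
    IsLocalMin (fun p : EuclideanSpace ℝ (Fin n) × ℝ => w p.1 p.2 - φ p) (x, t) →
    0 ≤ deriv (fun s => φ (x, s)) t +
      f (w x t) (mass Θ {y | w y t ≤ w x t}) * ‖fderiv ℝ (fun y => φ (y, t)) x‖

variable {w : EuclideanSpace ℝ (Fin n) → ℝ → ℝ}

theorem continuous_slice (hwc : ContinuousOn (Function.uncurry w) (univ ×ˢ Ici 0)) {t : ℝ}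
    (ht : 0 ≤ t) : Continuous fun x => w x t :=
  continuousOn_univ.1 (hwc.comp (f := fun x : EuclideanSpace ℝ (Fin n) => (x, t))
    (by fun_prop) fun _ _ => ⟨mem_univ _, ht⟩)

/-- Below the level `k` the nonlocal velocity is at most the one belonging to the sublevel set
`{w < k}`, because the velocity is monotone both in the level and in the mass. -/
theorem IsSuper.speedLE (hw : IsSuper f Θ w) (hf : IsSpeed f Q) (hΘ : IsDensity Θ) {k a b : ℝ}
    (ha : 0 ≤ a) {c : ℝ → ℝ} (hc : ∀ t ∈ Ioo a b, f k (mass Θ {y | w y t < k}) ≤ c t) :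
    SpeedLE w k c a b := by
  intro φ hφ x t ht hxk hmin
  refine (hw φ hφ x t (ha.trans_lt ht.1) hmin).trans ?_
  gcongr
  exact (hf.mono _ _ _ _ hxk.le (mass_mono hΘ fun y hy => lt_of_le_of_lt hy hxk)).trans (hc t ht)

/-- Finite speed of propagation. -/
theorem IsSuper.infEDist_le (hw : IsSuper f Θ w) (hf : IsSpeed f Q) (hΘ : IsDensity Θ)
    (hwc : ContinuousOn (Function.uncurry w) (univ ×ˢ Ici 0)) {M : ℝ} (hM : ∀ r q, |f r q| ≤ M)
    {k a t : ℝ} (ha : 0 ≤ a) (hat : a ≤ t) {x : EuclideanSpace ℝ (Fin n)} (hx : w x t < k) :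
    Metric.infEDist x {y | w y a < k} ≤ ENNReal.ofReal (M * (t - a)) := by
  have hM0 : 0 ≤ M := (abs_nonneg _).trans (hM 0 0)
  have := infEDist_le_of_speedLE hwc ha (continuous_const (y := M)) (fun _ _ => hM0)
    (hw.speedLE hf hΘ ha (b := t + 1) fun s _ => (le_abs_self _).trans (hM _ _))
    ⟨hat, by linarith⟩ hx
  simpa [mul_comm] using this

theorem monotone_speed_cthickening (hf : IsSpeed f Q) (hΘ : IsDensity Θ) (k : ℝ)
    (B : Set (EuclideanSpace ℝ (Fin n))) :
    Monotone fun s => f k (mass Θ (Metric.cthickening s B)) := fun _ _ hst =>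
  hf.mono _ _ _ _ le_rfl (mass_mono hΘ (Metric.cthickening_mono hst B))

theorem continuous_speed_cthickening (hf : IsSpeed f Q) (hΘ : IsDensity Θ) (k : ℝ)
    (B : Set (EuclideanSpace ℝ (Fin n))) :
    Continuous fun s => f k (mass Θ (Metric.cthickening s B)) :=
  hf.continuous_comp (continuous_mass_cthickening hΘ B) k

theorem speed_le_speed_cthickening (hf : IsSpeed f Q) (hΘ : IsDensity Θ) (k s : ℝ)
    (B : Set (EuclideanSpace ℝ (Fin n))) :
    f k (mass Θ B) ≤ f k (mass Θ (Metric.cthickening s B)) :=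
  hf.mono _ _ _ _ le_rfl (mass_mono hΘ (Metric.self_subset_cthickening B))

/-- An expanding sublevel set stays inside the parallel sets of its initial position which expand
with their own velocity. Starting from finite speed of propagation, each bound on the position of
the front bounds the nonlocal velocity and hence improves the bound on the position; these
improvements are the Picard iterates. -/
theorem IsSuper.exists_expanding_bound (hw : IsSuper f Θ w) (hf : IsSpeed f Q) (hΘ : IsDensity Θ)
    (hwc : ContinuousOn (Function.uncurry w) (univ ×ˢ Ici 0)) {k : ℝ}
    {B : Set (EuclideanSpace ℝ (Fin n))} (hB : B = {x | w x 0 < k}) (hk : 0 ≤ f k (mass Θ B)) :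
    ∃ y : ℝ → ℝ, Continuous y ∧
      (∀ t, 0 ≤ t → y t = ∫ s in (0 : ℝ)..t, f k (mass Θ (Metric.cthickening (y s) B))) ∧
      ∀ t, 0 ≤ t → ∀ x, w x t < k → Metric.infEDist x B ≤ ENNReal.ofReal (y t) := by
  obtain ⟨M, hM⟩ := hf.bounded
  set F : ℝ → ℝ := fun s => f k (mass Θ (Metric.cthickening s B)) with hF
  have hFm : Monotone F := monotone_speed_cthickening hf hΘ k B
  have hFc : Continuous F := continuous_speed_cthickening hf hΘ k B
  have hFM : ∀ s, |F s| ≤ M := fun s => hM _ _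
  have hF0 : ∀ s, 0 ≤ F s := fun s => hk.trans (speed_le_speed_cthickening hf hΘ k s B)
  obtain ⟨y, hyc, hyF, hlim, -⟩ :=
    exists_maximal_solution hFm hFM fun s => hFc.continuousWithinAt
  refine ⟨y, hyc, hyF, fun t ht x hx => ?_⟩
  have key : ∀ j t, 0 ≤ t → ∀ x, w x t < k →
      Metric.infEDist x B ≤ ENNReal.ofReal (picard F M j t) := by
    intro j
    induction j with
    | zero =>
      intro t ht x hx
      have := hw.infEDist_le hf hΘ hwc hM le_rfl ht hx
      rwa [sub_zero, ← hB] at this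
    | succ j ih =>
      intro t ht x hx
      have hs : SpeedLE w k (fun s => F (picard F M j s)) 0 (t + 1) :=
        hw.speedLE hf hΘ le_rfl fun s hs =>
          hf.mono _ _ _ _ le_rfl (mass_mono hΘ fun z hz => ih s hs.1.le z hz)
      have := infEDist_le_of_speedLE hwc le_rfl (hFc.comp (continuous_picard hFm hFM j))
        (fun s _ => hF0 _) hs ⟨ht, by linarith⟩ hx
      rwa [← hB] at this
  exact ge_of_tendsto ((ENNReal.continuous_ofReal.tendsto _).comp (hlim t ht))
    (Eventually.of_forall fun j => key j t ht x hx)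

/-- A sublevel set whose closure has negative velocity never leaves its initial position. By
finite speed of propagation the velocity stays nonpositive for a time which does not depend on
the starting time, so that finitely many steps reach every time. -/
theorem IsSuper.lt_of_lt (hw : IsSuper f Θ w) (hf : IsSpeed f Q) (hΘ : IsDensity Θ)
    (hwc : ContinuousOn (Function.uncurry w) (univ ×ˢ Ici 0)) {k : ℝ}
    (hk : f k (mass Θ {x | w x 0 ≤ k}) < 0) {t : ℝ} (ht : 0 ≤ t) {x : EuclideanSpace ℝ (Fin n)}
    (hx : w x t < k) : w x 0 < k := by
  obtain ⟨M, hM⟩ := hf.bounded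
  have hM0 : 0 ≤ M := (abs_nonneg _).trans (hM 0 0)
  have hw0 : Continuous fun x => w x 0 := continuous_slice hwc le_rfl
  set B : Set (EuclideanSpace ℝ (Fin n)) := {x | w x 0 < k} with hB
  have hg := (continuous_speed_cthickening hf hΘ k B).continuousAt (x := 0)
  have hg0 : f k (mass Θ (Metric.cthickening 0 B)) < 0 := by
    refine lt_of_le_of_lt (hf.mono _ _ _ _ le_rfl (mass_mono hΘ ?_)) hk
    rw [Metric.cthickening_zero]
    exact closure_minimal (fun x (hx : w x 0 < k) => hx.le) (isClosed_le hw0 continuous_const)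
  obtain ⟨r, hr, hball⟩ := Metric.eventually_nhds_iff_ball.1 (hg.eventually_lt_const hg0)
  have hneg : f k (mass Θ (Metric.cthickening (r / 2) B)) < 0 := by
    refine hball _ ?_
    rw [Metric.mem_ball, Real.dist_eq, sub_zero, abs_of_pos (half_pos hr)]
    exact half_lt_self hr
  set τ : ℝ := r / (4 * (M + 1)) with hτ
  have hτ0 : 0 < τ := by positivity
  have hMτ : M * (2 * τ) ≤ r / 2 := by
    have : (M + 1) * (2 * τ) = r / 2 := by rw [hτ]; field_simp; norm_num
    nlinarith
  have key : ∀ j : ℕ, ∀ t, 0 ≤ t → t ≤ j * τ → ∀ x, w x t < k → w x 0 < k := by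
    intro j
    induction j with
    | zero =>
      intro t ht htj x hx
      have : t = 0 := le_antisymm (by simpa using htj) ht
      rwa [this] at hx
    | succ j ih =>
      intro t ht htj x hx
      rcases le_or_gt t (j * τ) with h | h
      · exact ih t ht h x hx
      set a : ℝ := j * τ with ha
      have ha0 : 0 ≤ a := by positivity
      push_cast at htj
      have hs : SpeedLE w k (fun s => -(fun _ : ℝ => (0 : ℝ)) s) a (a + 2 * τ) := by
        refine hw.speedLE hf hΘ ha0 fun s hs => ?_
        rw [neg_zero]
        refine le_trans (hf.mono _ _ _ _ le_rfl (mass_mono hΘ fun z hz => ?_)) hneg.le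
        refine (Metric.infEDist_anti fun y hy => ih a ha0 le_rfl y hy).trans
          ((hw.infEDist_le hf hΘ hwc hM ha0 hs.1.le hz).trans (ENNReal.ofReal_le_ofReal ?_))
        refine le_trans ?_ hMτ
        gcongr
        linarith [hs.2]
      exact ih a ha0 le_rfl x (lt_of_speedLE_neg hwc ha0 continuous_const (fun _ _ => le_rfl) hs
        ⟨h.le, by linarith⟩ hx (by simp))
  obtain ⟨j, hj⟩ := exists_nat_ge (t / τ)
  exact key j t ht ((div_le_iff₀ hτ0).1 hj) x hx

/-- A shrinking sublevel set keeps at least the distance `y(t)` from the complement of its initial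
position, where `y` grows with the velocity of the parallel sets. As for expanding sets, every bound
on the position improves itself, and the improvements are Picard iterates (of the reflected
right-hand side `s ↦ -F(-s)`, since the bounds now increase). -/
theorem IsSuper.exists_shrinking_bound (hw : IsSuper f Θ w) (hf : IsSpeed f Q) (hΘ : IsDensity Θ)
    (hwc : ContinuousOn (Function.uncurry w) (univ ×ˢ Ici 0)) {k : ℝ}
    (hk : f k (mass Θ {x | w x 0 ≤ k}) < 0) {F : ℝ → ℝ} (hFc : Continuous F) (hFm : Monotone F)
    {M : ℝ} (hFM : ∀ s, |F s| ≤ M) (hF0 : ∀ s, 0 ≤ F s) {C : Set (EuclideanSpace ℝ (Fin n))}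
    (hC : C = {x | k ≤ w x 0})
    (hF : ∀ s, f k (mass Θ {x | x ∉ C ∧ ENNReal.ofReal s ≤ Metric.infEDist x C}) ≤ -F s) :
    ∃ y : ℝ → ℝ, Continuous y ∧ (∀ t, 0 ≤ t → y t = ∫ s in (0 : ℝ)..t, F (y s)) ∧
      ∀ t, 0 ≤ t → ∀ x, w x t < k → ENNReal.ofReal (y t) ≤ Metric.infEDist x C := by
  have hM0 : 0 ≤ M := (abs_nonneg _).trans (hFM 0)
  set G : ℝ → ℝ := fun s => -F (-s) with hG
  have hGm : Monotone G := fun s t hst => neg_le_neg (hFm (neg_le_neg hst))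
  have hGc : Continuous G := (hFc.comp continuous_neg).neg
  have hGM : ∀ s, |G s| ≤ M := fun s => by rw [hG, abs_neg]; exact hFM _
  obtain ⟨z, hzc, hzG, hlim, -⟩ :=
    exists_maximal_solution hGm hGM fun s => hGc.continuousWithinAt
  refine ⟨fun t => -z t, hzc.neg, fun t ht => ?_, fun t ht x hx => ?_⟩
  · simp only
    rw [hzG t ht, ← intervalIntegral.integral_neg]
    simp [hG]
  have key : ∀ j t, 0 ≤ t → ∀ x, w x t < k →
      ENNReal.ofReal (-picard G M j t) ≤ Metric.infEDist x C := by
    intro j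
    induction j with
    | zero =>
      intro t ht x hx
      have : -picard G M 0 t ≤ 0 := neg_nonpos.2 (mul_nonneg hM0 ht)
      rw [ENNReal.ofReal_of_nonpos this]
      exact zero_le
    | succ j ih =>
      intro t ht x hx
      have hs : SpeedLE w k (fun s => -F (-picard G M j s)) 0 (t + 1) := by
        refine hw.speedLE hf hΘ le_rfl fun s hs => ?_
        refine le_trans (hf.mono _ _ _ _ le_rfl (mass_mono hΘ fun z hz => ?_)) (hF _)
        refine ⟨?_, ih s hs.1.le z hz⟩
        rw [hC]
        exact not_le.2 (hw.lt_of_lt hf hΘ hwc hk hs.1.le hz)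
      have hint : -picard G M (j + 1) t = ∫ s in (0 : ℝ)..t, F (-picard G M j s) := by
        show -(∫ s in (0 : ℝ)..t, G (picard G M j s)) = _
        rw [← intervalIntegral.integral_neg]
        simp [hG]
      rw [hint, Metric.le_infEDist]
      intro y hy
      by_contra hlt
      rw [not_le, edist_dist] at hlt
      have hd : dist x y ≤ ∫ s in (0 : ℝ)..t, F (-picard G M j s) :=
        (ENNReal.ofReal_lt_ofReal_iff_of_nonneg dist_nonneg).1 hlt |>.le
      rw [hC] at hy
      exact not_lt.2 hy (lt_of_speedLE_neg hwc le_rfl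
        (hFc.comp (continuous_picard hGm hGM j).neg) (fun s _ => hF0 _) hs ⟨ht, by linarith⟩ hx hd)
  exact le_of_tendsto ((ENNReal.continuous_ofReal.tendsto _).comp (hlim t ht).neg)
    (Eventually.of_forall fun j => key j t ht x hx)

end Front

section Level

variable {n : ℕ} {f : ℝ → ℝ≥0 → ℝ} {Θ : EuclideanSpace ℝ (Fin n) → ℝ}
  {u₀ : EuclideanSpace ℝ (Fin n) → ℝ} {w : EuclideanSpace ℝ (Fin n) → ℝ → ℝ} {h k : ℝ}

/-- A continuous solution of the Cauchy problem: `w` is a supersolution for `f`, and the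
subsolution property is expressed as the supersolution property of `-w` for the dual velocity. -/
structure IsFlow (f : ℝ → ℝ≥0 → ℝ) (Θ : EuclideanSpace ℝ (Fin n) → ℝ)
    (u₀ : EuclideanSpace ℝ (Fin n) → ℝ) (w : EuclideanSpace ℝ (Fin n) → ℝ → ℝ) : Prop where
  continuousOn : ContinuousOn (Function.uncurry w) (univ ×ˢ Ici 0)
  super : IsSuper f Θ w
  sub : IsSuper (dualSpeed f (mass Θ univ)) Θ (fun x t => -w x t)
  initial : ∀ x, w x 0 = u₀ x

theorem IsFlow.continuous_initial (hw : IsFlow f Θ u₀ w) : Continuous u₀ := by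
  rw [← funext hw.initial]
  exact continuous_slice hw.continuousOn le_rfl

theorem IsFlow.setOf_lt_eq (hw : IsFlow f Θ u₀ w) (k : ℝ) : {x | w x 0 < k} = subD u₀ k := by
  ext x; simp [subD, hw.initial]

theorem IsFlow.expanding_bound (hw : IsFlow f Θ u₀ w) (hf : IsSpeed f (mass Θ univ))
    (hΘ : IsDensity Θ) (hk : 0 ≤ f k (mass Θ (subD u₀ k))) : ∃ y : ℝ → ℝ, Continuous y ∧
      (∀ t, 0 ≤ t → y t = ∫ s in (0 : ℝ)..t, f k (mass Θ (Metric.cthickening (y s) (subD u₀ k)))) ∧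
      ∀ t, 0 ≤ t → ∀ x, w x t < k → Metric.infEDist x (subD u₀ k) ≤ ENNReal.ofReal (y t) :=
  hw.super.exists_expanding_bound hf hΘ hw.continuousOn (hw.setOf_lt_eq k).symm hk

theorem IsFlow.shrinking_bound (hw : IsFlow f Θ u₀ w) (hf : IsSpeed f (mass Θ univ))
    (hΘ : IsDensity Θ) (hk : 0 < f k (mass Θ (subD u₀ k))) : ∃ y : ℝ → ℝ, Continuous y ∧
      (∀ t, 0 ≤ t → y t = ∫ s in (0 : ℝ)..t, f k (mass Θ (Metric.cthickening (y s) (subE u₀ k)))) ∧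
      ∀ t, 0 ≤ t → ∀ x, k < w x t → ENNReal.ofReal (y t) ≤ Metric.infEDist x (subE u₀ k) := by
  obtain ⟨M, hM⟩ := hf.bounded
  have hu := hw.continuous_initial
  have hC : IsClosed (subE u₀ k) := isClosed_subE hu
  have hDE : subD u₀ k ⊆ subE u₀ k := fun x (hx : u₀ x < k) => hx.le
  have hset : {x | -w x 0 ≤ -k} = (subD u₀ k)ᶜ := by
    ext x; simp [subD, hw.initial]
  obtain ⟨y, hyc, hyF, hy⟩ := hw.sub.exists_shrinking_bound hf.dual hΘ hw.continuousOn.neg (k := -k)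
    (by rw [hset, dualSpeed_mass_compl hΘ (isOpen_subD hu).measurableSet]; linarith)
    (continuous_speed_cthickening hf hΘ k (subE u₀ k))
    (monotone_speed_cthickening hf hΘ k (subE u₀ k)) (fun s => hM _ _)
    (fun s => hk.le.trans ((hf.mono _ _ _ _ le_rfl (mass_mono hΘ hDE)).trans
      (speed_le_speed_cthickening hf hΘ k s _))) (C := subE u₀ k)
    (by ext x; simp [subE, hw.initial]) (fun s => by
      set T : Set (EuclideanSpace ℝ (Fin n)) :=
        {x | x ∈ subE u₀ k ∨ Metric.infEDist x (subE u₀ k) < ENNReal.ofReal s} with hT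
      have hTm : MeasurableSet T := hC.measurableSet.union
        (isOpen_lt Metric.continuous_infEDist continuous_const).measurableSet
      have hTc : {x | x ∉ subE u₀ k ∧ ENNReal.ofReal s ≤ Metric.infEDist x (subE u₀ k)} = Tᶜ := by
        ext x; simp [hT]
      rw [hTc, dualSpeed_mass_compl hΘ hTm]
      have hmass : mass Θ T = mass Θ (Metric.cthickening s (subE u₀ k)) := by
        rcases lt_or_ge 0 s with hs | hs
        · refine mass_congr ?_
          filter_upwards [ae_infEDist_ne (subE u₀ k) hs] with x hx
          constructor
          · rintro (h | h)
            exacts [Metric.self_subset_cthickening _ h, h.le]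
          · exact fun h => Or.inr (lt_of_le_of_ne h hx)
        · rw [Metric.cthickening_of_nonpos hs, hC.closure_eq]
          congr 1
          ext x
          simp [hT, ENNReal.ofReal_of_nonpos hs]
      rw [hmass])
  exact ⟨y, hyc, hyF, fun t ht x hx => hy t ht x (neg_lt_neg hx)⟩

/-- The closed parallel sets of `{u₀ ≤ h}` are the limits of those of `{u₀ < k}` as `k ↓ h`; the
compactness of balls makes up for that of the sublevel sets. -/
theorem eventually_mem_cthickening_subD_iff (hu : Continuous u₀) {ι : Type*} {L : Filter ι}
    {k : ι → ℝ} (hk : Tendsto k L (𝓝 h)) (hkh : ∀ i, h < k i) {s : ℝ} (hs : 0 ≤ s)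
    (x : EuclideanSpace ℝ (Fin n)) :
    ∀ᶠ i in L, x ∈ Metric.cthickening s (subD u₀ (k i)) ↔ x ∈ Metric.cthickening s (subE u₀ h) := by
  have hsub : ∀ i, subE u₀ h ⊆ subD u₀ (k i) := fun i y (hy : u₀ y ≤ h) => hy.trans_lt (hkh i)
  by_cases hx : x ∈ Metric.cthickening s (subE u₀ h)
  · exact Eventually.of_forall fun i =>
      iff_of_true (Metric.cthickening_subset_of_subset s (hsub i) hx) hx
  rw [Metric.mem_cthickening_iff, not_le, ENNReal.lt_iff_exists_real_btwn] at hx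
  obtain ⟨r, hr0, hsr, hrx⟩ := hx
  have hsr' : s < r := (ENNReal.ofReal_lt_ofReal_iff_of_nonneg hs).1 hsr
  obtain ⟨z, hzr, hz⟩ := (isCompact_closedBall x r).exists_isMinOn
    ⟨x, Metric.mem_closedBall_self hr0⟩ hu.continuousOn
  have hzh : h < u₀ z := by
    by_contra hle
    rw [not_lt] at hle
    refine absurd hrx (not_lt.2 ((Metric.infEDist_le_edist_of_mem (show z ∈ subE u₀ h from
      hle)).trans ?_))
    rw [edist_comm, edist_dist]
    exact ENNReal.ofReal_le_ofReal hzr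
  filter_upwards [hk.eventually_lt_const hzh] with i hi
  refine iff_of_false ?_ ?_
  · rw [Metric.mem_cthickening_iff, not_le]
    refine hsr.trans_le (Metric.le_infEDist.2 fun y hy => ?_)
    by_contra hlt
    rw [not_le, edist_dist, ENNReal.ofReal_lt_ofReal_iff_of_nonneg dist_nonneg, dist_comm] at hlt
    exact absurd ((isMinOn_iff.1 hz y hlt.le).trans_lt hy) (not_lt.2 hi.le)
  · rw [Metric.mem_cthickening_iff, not_le]
    exact hsr.trans hrx

theorem tendsto_add_one_div (h c : ℝ) :
    Tendsto (fun j : ℕ => h + c * (1 / ((j : ℝ) + 1))) atTop (𝓝 h) := by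
  simpa using (tendsto_one_div_add_atTop_nhds_zero_nat (𝕜 := ℝ)).const_mul c |>.const_add h

/-- Outer bound for the front at an advancing level `h`, obtained from the strict sublevel sets
at the levels `k ↓ h`. -/
theorem IsFlow.outer_front (hw : IsFlow f Θ u₀ w) (hf : IsSpeed f (mass Θ univ)) (hΘ : IsDensity Θ)
    (hpos : 0 < f h (mass Θ (subD u₀ h))) {y : ℝ → ℝ} (hyc : Continuous y)
    (hyF : ∀ t, 0 ≤ t →
      y t = ∫ s in (0 : ℝ)..t, f h (mass Θ (Metric.cthickening (y s) (subE u₀ h))))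
    {t : ℝ} (ht : 0 ≤ t) {x : EuclideanSpace ℝ (Fin n)} (hx : w x t ≤ h) :
    Metric.infEDist x (subE u₀ h) ≤ ENNReal.ofReal (y t) := by
  have hu := hw.continuous_initial
  set c := f h (mass Θ (subD u₀ h)) with hc
  set k : ℕ → ℝ := fun j => h + 1 * (1 / ((j : ℝ) + 1)) with hk
  have hkh : ∀ j, h < k j := fun j => by
    have : (0 : ℝ) < 1 * (1 / ((j : ℝ) + 1)) := by positivity
    simp only [hk]; linarith
  have hklim : Tendsto k atTop (𝓝 h) := tendsto_add_one_div h 1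
  have hck : ∀ j, c ≤ f (k j) (mass Θ (subD u₀ (k j))) := fun j =>
    hf.mono _ _ _ _ (hkh j).le (mass_mono hΘ fun z (hz : u₀ z < h) => hz.trans (hkh j))
  have hcE : c ≤ f h (mass Θ (subE u₀ h)) :=
    hf.mono _ _ _ _ le_rfl (mass_mono hΘ fun z (hz : u₀ z < h) => hz.le)
  choose Y hYc hYF hY using fun j => hw.expanding_bound hf hΘ (hpos.le.trans (hck j))
  have hlim := tendsto_solution
    (G := fun j s => f (k j) (mass Θ (Metric.cthickening s (subD u₀ (k j)))))
    (F := fun s => f h (mass Θ (Metric.cthickening s (subE u₀ h))))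
    (fun j => continuous_speed_cthickening hf hΘ _ _) hpos
    (fun j s => (hck j).trans (speed_le_speed_cthickening hf hΘ _ _ _))
    (continuous_speed_cthickening hf hΘ _ _)
    (fun s => hcE.trans (speed_le_speed_cthickening hf hΘ _ _ _))
    (fun s hs => hf.tendsto hklim (tendsto_mass hΘ
      (fun _ => Metric.isClosed_cthickening.measurableSet)
      Metric.isClosed_cthickening.measurableSet
      (Eventually.of_forall fun z => eventually_mem_cthickening_subD_iff hu hklim hkh hs.le z)))
    hYc hYF hyc hyF ht
  by_contra hlt
  rw [not_le, ENNReal.lt_iff_exists_real_btwn] at hlt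
  obtain ⟨s, hs0, hys, hsx⟩ := hlt
  have hys' : y t < s := ENNReal.lt_ofReal_iff_toReal_lt ENNReal.ofReal_ne_top |>.1 hys
    |> fun h => (le_max_left _ _).trans_lt (by simpa [ENNReal.toReal_ofReal'] using h)
  obtain ⟨j, hj1, hj2⟩ := ((hlim.eventually_lt_const hys').and
    (eventually_mem_cthickening_subD_iff hu hklim hkh hs0 x)).exists
  have h1 : x ∈ Metric.cthickening s (subD u₀ (k j)) :=
    (hY j t ht x (hx.trans_lt (hkh j))).trans (ENNReal.ofReal_le_ofReal hj1.le)
  exact absurd (hj2.1 h1) (not_le.2 hsx)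

/-- Inner bound for the front at an advancing level `h`, obtained from the levels `k ↑ h`. -/
theorem IsFlow.inner_front (hw : IsFlow f Θ u₀ w) (hf : IsSpeed f (mass Θ univ)) (hΘ : IsDensity Θ)
    (hkh : k < h) (hpos : 0 < f k (mass Θ (subD u₀ k))) {y : ℝ → ℝ} (hyc : Continuous y)
    (hyF : ∀ t, 0 ≤ t →
      y t = ∫ s in (0 : ℝ)..t, f h (mass Θ (Metric.cthickening (y s) (subD u₀ h))))
    {t : ℝ} (ht : 0 ≤ t) {x : EuclideanSpace ℝ (Fin n)}
    (hx : Metric.infEDist x (subD u₀ h) < ENNReal.ofReal (y t)) : w x t < h := by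
  set c := f k (mass Θ (subD u₀ k)) with hc
  set K : ℕ → ℝ := fun j => h + (k - h) * (1 / ((j : ℝ) + 1)) with hK
  have hKh : ∀ j, K j < h := fun j => by
    have : (0 : ℝ) < 1 / ((j : ℝ) + 1) := by positivity
    simp only [hK]; nlinarith
  have hkK : ∀ j, k ≤ K j := fun j => by
    have : 1 / ((j : ℝ) + 1) ≤ 1 := by
      rw [div_le_one (by positivity)]
      linarith [(Nat.cast_nonneg j : (0 : ℝ) ≤ j)]
    simp only [hK]; nlinarith
  have hKlim : Tendsto K atTop (𝓝 h) := tendsto_add_one_div h (k - h)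
  have hcD : ∀ k', k ≤ k' → c ≤ f k' (mass Θ (subD u₀ k')) := fun k' hk' =>
    hf.mono _ _ _ _ hk' (mass_mono hΘ fun z (hz : u₀ z < k) => hz.trans_le hk')
  have hcE : ∀ k', k ≤ k' → c ≤ f k' (mass Θ (subE u₀ k')) := fun k' hk' =>
    (hcD k' hk').trans (hf.mono _ _ _ _ le_rfl (mass_mono hΘ fun z (hz : u₀ z < k') => hz.le))
  have hED : ∀ j, subE u₀ (K j) ⊆ subD u₀ h := fun j z (hz : u₀ z ≤ K j) => hz.trans_lt (hKh j)
  choose Y hYc hYF hY using fun j => hw.shrinking_bound hf hΘ (hpos.trans_le (hcD _ (hkK j)))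
  have hnear : ∀ s : ℝ, ∀ z, Metric.infEDist z (subD u₀ h) < ENNReal.ofReal s →
      ∀ᶠ j in atTop, Metric.infEDist z (subE u₀ (K j)) < ENNReal.ofReal s := by
    intro s z hz
    obtain ⟨v, hv, hzv⟩ := Metric.infEDist_lt_iff.1 hz
    filter_upwards [hKlim.eventually_const_lt hv] with j hj
    exact Metric.infEDist_lt_iff.2 ⟨v, hj.le, hzv⟩
  have hlim := tendsto_solution
    (G := fun j s => f (K j) (mass Θ (Metric.cthickening s (subE u₀ (K j)))))
    (F := fun s => f h (mass Θ (Metric.cthickening s (subD u₀ h))))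
    (fun j => continuous_speed_cthickening hf hΘ _ _) hpos
    (fun j s => (hcE _ (hkK j)).trans (speed_le_speed_cthickening hf hΘ _ _ _))
    (continuous_speed_cthickening hf hΘ _ _)
    (fun s => (hcD h hkh.le).trans (speed_le_speed_cthickening hf hΘ _ _ _))
    (fun s hs => hf.tendsto hKlim (tendsto_mass hΘ
      (fun _ => Metric.isClosed_cthickening.measurableSet)
      Metric.isClosed_cthickening.measurableSet (by
        filter_upwards [ae_infEDist_ne (subD u₀ h) hs] with z hz
        rcases lt_or_gt_of_ne hz with hlt | hgt
        · filter_upwards [hnear s z hlt] with j hj using iff_of_true hj.le hlt.le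
        · exact Eventually.of_forall fun j => iff_of_false (not_le.2 (hgt.trans_le
            (Metric.infEDist_anti (hED j)))) (not_le.2 hgt))))
    hYc hYF hyc hyF ht
  rw [ENNReal.lt_iff_exists_real_btwn] at hx
  obtain ⟨s, hs0, hxs, hsy⟩ := hx
  have hsy' : s < y t := (ENNReal.ofReal_lt_ofReal_iff_of_nonneg hs0).1 hsy
  obtain ⟨j, hj1, hj2⟩ := ((hlim.eventually_const_lt hsy').and (hnear s x hxs)).exists
  by_contra hge
  rw [not_lt] at hge
  have h1 := hY j t ht x ((hKh j).trans_le hge)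
  exact absurd (h1.trans_lt hj2) (not_lt.2 (ENNReal.ofReal_le_ofReal hj1.le))

end Level

/-! ### Levels above the threshold -/

section Above

variable {n : ℕ} {f : ℝ → ℝ≥0 → ℝ} {Q : ℝ≥0} {Θ : EuclideanSpace ℝ (Fin n) → ℝ}
  {u₀ : EuclideanSpace ℝ (Fin n) → ℝ} {w : EuclideanSpace ℝ (Fin n) → ℝ → ℝ} {h hbar : ℝ}

theorem parD_of_subD_eq_empty (hD : subD u₀ h = ∅) (s : ℝ) : parD u₀ h s = ∅ := by
  ext x; simp [parD, sgnDist, hD]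

theorem parD_of_subD_eq_univ (hD : subD u₀ h = univ) (s : ℝ) : parD u₀ h s = univ := by
  ext x; simp [parD, sgnDist, hD]

theorem parE_of_subE_eq_empty (hE : subE u₀ h = ∅) (s : ℝ) : parE u₀ h s = ∅ := by
  ext x; simp [parE, sgnDist, hE]

theorem parE_of_subE_eq_univ (hE : subE u₀ h = univ) (s : ℝ) : parE u₀ h s = univ := by
  ext x; simp [parE, sgnDist, hE]

theorem speed_subD_nonneg (hf : IsSpeed f Q) (hΘ : IsDensity Θ)
    (hthr : IsThreshold f Θ u₀ hbar) (hlt : hbar < h) : 0 ≤ f h (mass Θ (subD u₀ h)) :=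
  hthr.2.trans (hf.mono _ _ _ _ hlt.le
    (mass_mono hΘ fun _ (hx : u₀ _ ≤ hbar) => hx.trans_lt hlt))

/-- By connectedness the values of `u₀` have no gap between `hbar` and `h`, so the sublevel set at
`h` has larger mass than the one at `hbar`. -/
theorem speed_subD_pos (hf : IsSpeed f (mass Θ univ)) (hΘ : IsDensity Θ) (hu : Continuous u₀)
    (hthr : IsThreshold f Θ u₀ hbar) (hlt : hbar < h) {x y : EuclideanSpace ℝ (Fin n)}
    (hx : u₀ x < h) (hy : h ≤ u₀ y) : 0 < f h (mass Θ (subD u₀ h)) := by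
  obtain ⟨c, hc1, hc2⟩ := exists_between (max_lt hlt hx)
  obtain ⟨z, hz⟩ := mem_range_of_exists_le_of_exists_ge hu
    ⟨x, (le_max_right _ _).trans hc1.le⟩ ⟨y, hc2.le.trans hy⟩
  have hmass : mass Θ (subE u₀ hbar) < mass Θ (subD u₀ h) := by
    refine mass_lt hΘ (U := {z | hbar < u₀ z ∧ u₀ z < h})
      (fun v (hv : u₀ v ≤ hbar) => hv.trans_lt hlt) (isClosed_subE hu).measurableSet
      ((isOpen_lt continuous_const hu).inter (isOpen_lt hu continuous_const))
      ⟨z, ?_, ?_⟩ (fun v hv => ⟨hv.2, not_le.2 hv.1⟩)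
    · exact hz ▸ (le_max_left _ _).trans_lt hc1
    · exact hz ▸ hc2
  exact hthr.2.trans_lt ((hf.mono _ _ _ _ hlt.le le_rfl).trans_lt
    (hf.strict_mono_mass _ _ _ hmass (mass_mono hΘ (subset_univ _))))

theorem exists_deltaE_eq_of_pos (hf : IsSpeed f Q) (hΘ : IsDensity Θ)
    (hpos : 0 < f h (mass Θ (subD u₀ h))) : ∃ y : ℝ → ℝ, Continuous y ∧
      (∀ t, 0 ≤ t → y t = ∫ s in (0 : ℝ)..t, f h (mass Θ (Metric.cthickening (y s) (subE u₀ h)))) ∧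
      ∀ t, 0 ≤ t → deltaE f Θ u₀ t h = y t := by
  obtain ⟨M, hM⟩ := hf.bounded
  have hE : f h (mass Θ (subD u₀ h)) ≤ f h (mass Θ (subE u₀ h)) :=
    hf.mono _ _ _ _ le_rfl (mass_mono hΘ fun z (hz : u₀ z < h) => hz.le)
  obtain ⟨y, hyc, hyF, hy⟩ := exists_deltaE_eq hf hΘ u₀ h
  have hFc := continuous_speed_cthickening hf hΘ h (subE u₀ h)
  obtain ⟨z, hzc, hzF, -, -⟩ := exists_maximal_solution
    (monotone_speed_cthickening hf hΘ h (subE u₀ h)) (fun _ => hM _ _)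
    fun s => hFc.continuousWithinAt
  have hz0 : ∀ t, 0 ≤ t → 0 ≤ z t := fun t ht => le_trans (by positivity)
    (mul_le_solution hFc (fun s => hE.trans (speed_le_speed_cthickening hf hΘ h s _)) hzc hzF ht)
  -- `z` solves the evolution problem, so that the maximal solution is nonnegative as well
  have hzE : IsEvolution f Θ h (parE u₀ h) z := by
    refine isEvolution_parE_of_eq_integral hf hΘ hzc fun t ht => (hzF t ht).trans ?_
    refine intervalIntegral.integral_congr fun s hs => ?_
    rw [uIcc_of_le ht] at hs
    simp only [parE_eq_cthickening (hz0 s hs.1)]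
  have hy0 : ∀ t, 0 ≤ t → 0 ≤ y t := fun t ht => (hz0 t ht).trans
    (((isMaximalEvolution_deltaE hf hΘ).2 z hzE t ht).trans_eq (hy t ht))
  refine ⟨y, hyc, fun t ht => (hyF t ht).trans ?_, hy⟩
  refine intervalIntegral.integral_congr fun s hs => ?_
  rw [uIcc_of_le ht] at hs
  simp only [parE_eq_cthickening (hy0 s hs.1)]

theorem exists_deltaD_eq_of_pos (hf : IsSpeed f (mass Θ univ)) (hΘ : IsDensity Θ)
    (hu : Continuous u₀) (hpos : 0 < f h (mass Θ (subD u₀ h))) : ∃ y : ℝ → ℝ, Continuous y ∧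
      (∀ t, 0 ≤ t → y t = ∫ s in (0 : ℝ)..t, f h (mass Θ (Metric.cthickening (y s) (subD u₀ h)))) ∧
      ∀ t, 0 ≤ t → deltaD f Θ u₀ t h = y t := by
  obtain ⟨M, hM⟩ := hf.bounded
  obtain ⟨y, hyc, hyF, hy⟩ := exists_deltaD_eq hf hΘ u₀ h
  have hmono := monotone_speed_parD (u₀ := u₀) (h := h) hf hΘ
  have hF0 : 0 < f h (mass Θ (parD u₀ h 0)) := by rwa [parD_zero hu]
  -- left-continuity at `0` keeps the velocity positive on a whole neighbourhood of `0`
  obtain ⟨σ, hσ, hσpos⟩ : ∃ σ : ℝ, 0 < σ ∧ ∀ s, -σ < s → 0 ≤ f h (mass Θ (parD u₀ h s)) := by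
    have h1 := (continuousWithinAt_speed_parD (u₀ := u₀) (h := h) hf hΘ 0).eventually_const_lt hF0
    obtain ⟨l, hl, hl2⟩ := (mem_nhdsLE_iff_exists_Ioc_subset' (show (-1 : ℝ) < 0 by norm_num)).1 h1
    refine ⟨-l, neg_pos.2 hl, fun s hs => ?_⟩
    rcases le_or_gt s 0 with h0 | h0
    · have h2 : 0 < f h (mass Θ (parD u₀ h s)) := hl2 ⟨by linarith, h0⟩
      exact h2.le
    · exact hF0.le.trans (hmono h0.le)
  have hy0 : ∀ t, 0 ≤ t → 0 ≤ y t := fun t ht =>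
    nonneg_of_eq_integral hmono (fun _ => hM _ _) hyc hyF hσ hσpos ht
  have hypos : ∀ t, 0 < t → 0 < y t := by
    intro t ht
    rw [hyF t ht.le]
    have := intervalIntegral.integral_mono_on ht.le
      (intervalIntegrable_const (μ := volume) (c := f h (mass Θ (parD u₀ h 0))))
      (intervalIntegrable_comp hmono (fun _ => hM _ _) hyc.measurable 0 t)
      fun s hs => hmono (hy0 s hs.1)
    refine lt_of_lt_of_le ?_ this
    simpa using mul_pos ht hF0
  refine ⟨y, hyc, fun t ht => (hyF t ht).trans ?_, hy⟩
  refine intervalIntegral.integral_congr_ae (Eventually.of_forall fun s hs => ?_)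
  rw [uIoc_of_le ht] at hs
  rw [parD_eq_thickening (hypos s hs.1), mass_thickening _ (hypos s hs.1)]

/-- By finite speed of propagation the values of a solution stay in every half line that contains
the initial values; balls being compact, no coercivity is needed. -/
theorem IsSuper.const_lt (hw : IsSuper f Θ w) (hf : IsSpeed f Q) (hΘ : IsDensity Θ)
    (hwc : ContinuousOn (Function.uncurry w) (univ ×ˢ Ici 0)) (h0 : ∀ x, h < w x 0) {t : ℝ}
    (ht : 0 ≤ t) (x : EuclideanSpace ℝ (Fin n)) : h < w x t := by
  obtain ⟨M, hM⟩ := hf.bounded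
  have hM0 : 0 ≤ M := (abs_nonneg _).trans (hM 0 0)
  have hR : 0 ≤ M * t + 1 := by positivity
  obtain ⟨z, -, hz⟩ := (isCompact_closedBall x (M * t + 1)).exists_isMinOn
    ⟨x, Metric.mem_closedBall_self hR⟩ (continuous_slice hwc le_rfl).continuousOn
  by_contra hle
  rw [not_lt] at hle
  have h1 := hw.infEDist_le hf hΘ hwc hM le_rfl ht (hle.trans_lt (h0 z))
  rw [sub_zero] at h1
  have h2 : ENNReal.ofReal (M * t) < ENNReal.ofReal (M * t + 1) :=
    (ENNReal.ofReal_lt_ofReal_iff_of_nonneg (by positivity)).2 (by linarith)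
  obtain ⟨v, hv, hxv⟩ := Metric.infEDist_lt_iff.1 (h1.trans_lt h2)
  rw [edist_dist, ENNReal.ofReal_lt_ofReal_iff_of_nonneg dist_nonneg, dist_comm] at hxv
  exact absurd (isMinOn_iff.1 hz v hxv.le) (not_le.2 hv)

/-- The boundary of an open set has empty interior, so a level set of this form is not fat. -/
theorem level_set_of_eq {g : EuclideanSpace ℝ (Fin n) → ℝ} {O : Set (EuclideanSpace ℝ (Fin n))}
    (hO : IsOpen O) (h1 : {x | g x < h} = O) (h2 : {x | g x ≤ h} = closure O) :
    interior {x | g x = h} = ∅ ∧ closure {x | g x < h} = {x | g x ≤ h} ∧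
      {x | g x = h} = frontier O := by
  have h3 : {x | g x = h} = frontier O := by
    rw [hO.frontier_eq, ← h2, ← h1]
    ext x
    simp [le_antisymm_iff]
  refine ⟨?_, by rw [h1, h2], h3⟩
  rw [h3, ← frontier_compl]
  exact interior_frontier hO.isClosed_compl

/-- At a level above the threshold whose initial sublevel sets do not fatten, the sublevel sets of a
solution are the parallel sets prescribed by `deltaD = deltaE`. -/
theorem IsFlow.sublevel_eq_parD (hw : IsFlow f Θ u₀ w) (hf : IsSpeed f (mass Θ univ))
    (hΘ : IsDensity Θ) (hthr : IsThreshold f Θ u₀ hbar) (hlt : hbar < h)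
    (hcl : closure (subD u₀ h) = subE u₀ h) {t : ℝ} (ht : 0 ≤ t) :
    deltaD f Θ u₀ t h = deltaE f Θ u₀ t h ∧
      {x | w x t < h} = parD u₀ h (deltaD f Θ u₀ t h) ∧
      {x | w x t ≤ h} = closure (parD u₀ h (deltaD f Θ u₀ t h)) := by
  have hu := hw.continuous_initial
  rcases (subD u₀ h).eq_empty_or_nonempty with hD | ⟨a, ha⟩
  · have hE : subE u₀ h = ∅ := by rw [← hcl, hD, closure_empty]
    obtain ⟨y, -, hyF, hy⟩ := exists_deltaD_eq hf hΘ u₀ h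
    obtain ⟨z, -, hzF, hz⟩ := exists_deltaE_eq hf hΘ u₀ h
    have hgt : ∀ x, h < w x t := hw.super.const_lt hf hΘ hw.continuousOn (fun x => by
      rw [hw.initial]
      exact not_le.1 fun hle => (hE ▸ (show x ∈ subE u₀ h from hle) : x ∈ (∅ : Set _))) ht
    refine ⟨?_, ?_, ?_⟩
    · rw [hy t ht, hz t ht, hyF t ht, hzF t ht]
      simp only [parD_of_subD_eq_empty hD, parE_of_subE_eq_empty hE]
    · rw [parD_of_subD_eq_empty hD, eq_empty_iff_forall_notMem]
      exact fun x hx => lt_asymm (hgt x) hx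
    · rw [parD_of_subD_eq_empty hD, closure_empty, eq_empty_iff_forall_notMem]
      exact fun x hx => not_le.2 (hgt x) hx
  rcases (subD u₀ h)ᶜ.eq_empty_or_nonempty with hD | ⟨b, hb⟩
  · rw [compl_empty_iff] at hD
    have hE : subE u₀ h = univ := by rw [← hcl, hD, closure_univ]
    obtain ⟨y, -, hyF, hy⟩ := exists_deltaD_eq hf hΘ u₀ h
    obtain ⟨z, -, hzF, hz⟩ := exists_deltaE_eq hf hΘ u₀ h
    have hgt : ∀ x, -h < -w x t := hw.sub.const_lt hf.dual hΘ hw.continuousOn.neg (fun x => by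
      rw [hw.initial]
      exact neg_lt_neg (show x ∈ subD u₀ h from hD ▸ mem_univ x)) ht
    refine ⟨?_, ?_, ?_⟩
    · rw [hy t ht, hz t ht, hyF t ht, hzF t ht]
      simp only [parD_of_subD_eq_univ hD, parE_of_subE_eq_univ hE]
    · rw [parD_of_subD_eq_univ hD, eq_univ_iff_forall]
      exact fun x => neg_lt_neg_iff.1 (hgt x)
    · rw [parD_of_subD_eq_univ hD, closure_univ, eq_univ_iff_forall]
      exact fun x => (neg_lt_neg_iff.1 (hgt x)).le
  have ha' : u₀ a < h := ha
  have hb' : h ≤ u₀ b := not_lt.1 hb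
  have hpos := speed_subD_pos hf hΘ hu hthr hlt ha' hb'
  obtain ⟨k, hk1, hk2⟩ := exists_between (max_lt hlt ha')
  have hkpos := speed_subD_pos hf hΘ hu hthr ((le_max_left _ _).trans_lt hk1)
    ((le_max_right _ _).trans_lt hk1) (hk2.le.trans hb')
  obtain ⟨y, hyc, hyF, hy⟩ := exists_deltaD_eq_of_pos hf hΘ hu hpos
  obtain ⟨z, hzc, hzF, hz⟩ := exists_deltaE_eq_of_pos hf hΘ hpos
  have hFc := continuous_speed_cthickening hf hΘ h (subD u₀ h)
  have hcF := fun s => speed_le_speed_cthickening hf hΘ h s (subD u₀ h)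
  simp only [← hcl, Metric.cthickening_closure] at hzF
  have hyz : ∀ t, 0 ≤ t → y t = z t := fun t ht =>
    solution_unique hFc hpos hcF hyc hyF hzc hzF ht
  have houter : ∀ s, 0 ≤ s → ∀ x, w x s ≤ h →
      Metric.infEDist x (subD u₀ h) ≤ ENNReal.ofReal (y s) := fun s hs x hx => by
    have := hw.outer_front hf hΘ hpos hyc
      (by simpa only [← hcl, Metric.cthickening_closure] using hyF) hs hx
    rwa [← hcl, Metric.infEDist_closure] at this
  refine ⟨by rw [hy t ht, hz t ht, hyz t ht], ?_⟩
  rw [hy t ht]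
  rcases ht.eq_or_lt with rfl | htpos
  · have hy0 : y 0 = 0 := by rw [hyF 0 le_rfl]; simp
    rw [hy0, parD_zero hu, hcl]
    constructor <;> ext x <;> simp [hw.initial, subD, subE]
  have hypos : 0 < y t :=
    lt_of_lt_of_le (by positivity) (mul_le_solution hFc hcF hyc hyF ht)
  rw [parD_eq_thickening hypos, closure_thickening hypos]
  have hinner : Metric.thickening (y t) (subD u₀ h) ⊆ {x | w x t < h} := fun x hx =>
    hw.inner_front hf hΘ hk2 hkpos hyc hyF ht hx
  refine ⟨Subset.antisymm (fun x hx => ?_) hinner,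
    Subset.antisymm (fun x hx => houter t ht x hx) ?_⟩
  · -- the strict inequality at time `t` persists at earlier times, when the front is further back
    have hcont : ContinuousWithinAt (fun s => w x s) (Ici 0) t :=
      (hw.continuousOn.comp (f := fun s : ℝ => (x, s)) (by fun_prop)
        fun s hs => ⟨mem_univ _, hs⟩) t ht
    have hev := (hcont.continuousAt (Ici_mem_nhds htpos)).eventually_lt_const hx
    obtain ⟨s, hs1, hs2⟩ := ((hev.filter_mono nhdsWithin_le_nhds).and
      (Ioo_mem_nhdsLT htpos)).exists
    have hst : y s < y t := by
      rw [← (travelTime_strictMono hFc hpos hcF).lt_iff_lt,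
        travelTime_solution hFc hpos hcF hyc hyF hs2.1.le,
        travelTime_solution hFc hpos hcF hyc hyF ht]
      exact hs2.2
    exact (houter s hs2.1.le x (le_of_lt hs1)).trans_lt
      ((ENNReal.ofReal_lt_ofReal_iff hypos).2 hst)
  · rw [← closure_thickening hypos]
    exact (closure_mono hinner).trans (closure_minimal (fun x (hx : w x t < h) => hx.le)
      (isClosed_le (continuous_slice hw.continuousOn ht) continuous_const))

/-- At a level above the threshold whose initial sublevel sets fatten, the larger one has a strictly
larger velocity at small positive distances. -/
theorem deltaD_lt_deltaE (hf : IsSpeed f (mass Θ univ)) (hΘ : IsDensity Θ) (hu : Continuous u₀)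
    (hthr : IsThreshold f Θ u₀ hbar) (hlt : hbar < h) (hnot : ¬ IsThreshold f Θ u₀ h)
    (hcl : closure (subD u₀ h) ⊂ subE u₀ h) {t : ℝ} (ht : 0 < t) :
    deltaD f Θ u₀ t h < deltaE f Θ u₀ t h := by
  have h0 := speed_subD_nonneg hf hΘ hthr hlt
  have hDE : subD u₀ h ⊆ subE u₀ h := fun x (hx : u₀ x < h) => hx.le
  have hpos : 0 < f h (mass Θ (subD u₀ h)) := lt_of_not_ge fun hle =>
    hnot ⟨hle, h0.trans (hf.mono _ _ _ _ le_rfl (mass_mono hΘ hDE))⟩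
  obtain ⟨y, hyc, hyF, hy⟩ := exists_deltaD_eq_of_pos hf hΘ hu hpos
  obtain ⟨z, hzc, hzF, hz⟩ := exists_deltaE_eq_of_pos hf hΘ hpos
  rw [hy t ht.le, hz t ht.le]
  obtain ⟨p, hpE, hpD⟩ := exists_of_ssubset hcl
  rw [Metric.mem_closure_iff_infEDist_zero, ← ne_eq, ← pos_iff_ne_zero] at hpD
  obtain ⟨ρ, hρ0, hρ1, hρ2⟩ := ENNReal.lt_iff_exists_real_btwn.1 hpD
  have hρ : 0 < ρ := ENNReal.ofReal_pos.1 hρ1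
  refine solution_strict_mono (continuous_speed_cthickening hf hΘ h (subD u₀ h)) hpos
    (fun s => speed_le_speed_cthickening hf hΘ h s (subD u₀ h))
    (continuous_speed_cthickening hf hΘ h (subE u₀ h))
    (fun s => hf.mono _ _ _ _ le_rfl (mass_mono hΘ (Metric.cthickening_subset_of_subset s hDE)))
    (half_pos hρ) (fun s hs hsρ => hf.strict_mono_mass _ _ _
      (mass_lt hΘ (Metric.cthickening_subset_of_subset s hDE)
        Metric.isClosed_cthickening.measurableSet Metric.isOpen_ball
        ⟨p, Metric.mem_ball_self hs⟩ fun v hv => ?_) (mass_mono hΘ (subset_univ _)))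
    hyc hyF hzc hzF ht
  have hvp : edist v p ≤ ENNReal.ofReal s := by
    rw [edist_dist]; exact ENNReal.ofReal_le_ofReal (le_of_lt hv)
  refine ⟨(Metric.infEDist_le_edist_of_mem hpE).trans hvp, fun hvD => ?_⟩
  refine absurd hρ2 (not_lt.2 ?_)
  calc Metric.infEDist p (subD u₀ h) ≤ Metric.infEDist v (subD u₀ h) + edist p v :=
        Metric.infEDist_le_infEDist_add_edist
    _ ≤ ENNReal.ofReal s + ENNReal.ofReal s := add_le_add hvD (edist_comm p v ▸ hvp)
    _ = ENNReal.ofReal (s + s) := (ENNReal.ofReal_add hs.le hs.le).symm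
    _ ≤ ENNReal.ofReal ρ := ENNReal.ofReal_le_ofReal (by linarith)

end Above

/-! ### Levels below the threshold -/

section Below

variable {n : ℕ} {f : ℝ → ℝ≥0 → ℝ} {Θ : EuclideanSpace ℝ (Fin n) → ℝ}
  {u₀ : EuclideanSpace ℝ (Fin n) → ℝ} {w : EuclideanSpace ℝ (Fin n) → ℝ → ℝ} {h hbar : ℝ}

theorem IsCauchySolution.isFlow (hu : IsCauchySolution f Θ u₀ w) (hΘ : IsDensity Θ) :
    IsFlow f Θ u₀ w where
  continuousOn := hu.continuousOn
  super := by
    intro φ hφ x t ht hmin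
    have := hu.super.test φ hφ.contDiffOn x t ht hmin
    rwa [mul_comm, gradient, LinearIsometryEquiv.norm_map] at this
  sub := by
    intro φ hφ x t ht hmin
    have hmax : IsLocalMax (fun p : EuclideanSpace ℝ (Fin n) × ℝ => w p.1 p.2 - (-φ) p) (x, t) := by
      refine hmin.neg.congr (Eventually.of_forall fun p => ?_)
      simp; ring
    have h1 := hu.sub.test (-φ) hφ.neg.contDiffOn x t ht hmax
    have hset : {y | -w y t ≤ -w x t} = {y | w y t < w x t}ᶜ := by
      ext y; simp
    have hm : MeasurableSet {y | w y t < w x t} :=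
      (isOpen_lt (continuous_slice hu.continuousOn ht.le) continuous_const).measurableSet
    rw [hset, dualSpeed_mass_compl hΘ hm]
    have h2 : deriv (fun s => (-φ) (x, s)) t = -deriv (fun s => φ (x, s)) t := deriv.fun_neg
    have h3 : ‖gradient (fun y => (-φ) (y, t)) x‖ = ‖fderiv ℝ (fun y => φ (y, t)) x‖ := by
      rw [gradient, LinearIsometryEquiv.norm_map]
      simp only [Pi.neg_apply, fderiv_fun_neg, norm_neg]
    rw [h2, h3] at h1
    linarith
  initial := hu.initial

theorem IsFlow.dual (hw : IsFlow f Θ u₀ w) (hΘ : IsDensity Θ) :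
    IsFlow (dualSpeed f (mass Θ univ)) Θ (-u₀) (fun x t => -w x t) where
  continuousOn := hw.continuousOn.neg
  super := hw.sub
  sub := by
    intro φ hφ x t ht hmin
    simp only [neg_neg, dualSpeed_dualSpeed_mass hΘ] at hmin ⊢
    exact hw.super φ hφ x t ht hmin
  initial := fun x => by simp [hw.initial]

theorem IsThreshold.dual (hΘ : IsDensity Θ) (hu : Continuous u₀) (k : ℝ) :
    IsThreshold (dualSpeed f (mass Θ univ)) Θ (-u₀) (-k) ↔ IsThreshold f Θ u₀ k := by
  rw [IsThreshold, IsThreshold, subD_neg, subE_neg,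
    dualSpeed_mass_compl hΘ (isClosed_subE hu).measurableSet,
    dualSpeed_mass_compl hΘ (isOpen_subD hu).measurableSet, neg_nonpos, neg_nonneg, and_comm]

theorem deltaE_eq_neg_deltaD (hΘ : IsDensity Θ) (t : ℝ) :
    deltaE f Θ u₀ t h = -deltaD (dualSpeed f (mass Θ univ)) Θ (-u₀) t (-h) := by
  rw [deltaD_eq_neg_deltaE hΘ, neg_neg, neg_neg, neg_neg]
  have : ∀ δ, IsEvolution (dualSpeed (dualSpeed f (mass Θ univ)) (mass Θ univ)) Θ h (parE u₀ h) δ ↔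
      IsEvolution f Θ h (parE u₀ h) δ := fun δ => by
    constructor <;> rintro ⟨h1, h2, h3⟩ <;> refine ⟨h1, h2, ?_⟩ <;>
      simpa only [dualSpeed_dualSpeed_mass hΘ] using h3
  simp only [deltaE, this]

end Below

end NonlocalHJ

theorem theorem1p2 (n : ℕ) (hn : 1 ≤ n)
    (f : ℝ → ℝ≥0 → ℝ) (hf : NonlocalHJ.IsVelocity f)
    (Θ : EuclideanSpace ℝ (Fin n) → ℝ) (hΘ : NonlocalHJ.IsDensity Θ)
    (u₀ : EuclideanSpace ℝ (Fin n) → ℝ) (hu₀ : NonlocalHJ.IsInitialValue u₀)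
    (hbar : ℝ) (hhbar : NonlocalHJ.IsThreshold f Θ u₀ hbar)
    (u : EuclideanSpace ℝ (Fin n) → ℝ → ℝ) (hu : NonlocalHJ.IsCauchySolution f Θ u₀ u)
    (h : ℝ) (hne : h ≠ hbar) :
    -- the pointwise extrema defining `δ_D`, `δ_E` are the minimal and the maximal solution
    (NonlocalHJ.IsMinimalEvolution f Θ h (NonlocalHJ.parD u₀ h)
        (fun t => NonlocalHJ.deltaD f Θ u₀ t h) ∧
      NonlocalHJ.IsMaximalEvolution f Θ h (NonlocalHJ.parE u₀ h)
        (fun t => NonlocalHJ.deltaE f Θ u₀ t h)) ∧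
    -- (a)
    ((hbar < h → closure (NonlocalHJ.subD u₀ h) = NonlocalHJ.subE u₀ h) →
      (h < hbar → NonlocalHJ.subD u₀ h = interior (NonlocalHJ.subE u₀ h)) →
      (∀ t, 0 ≤ t → NonlocalHJ.deltaD f Θ u₀ t h = NonlocalHJ.deltaE f Θ u₀ t h) ∧
      (∀ t, 0 ≤ t →
        interior {x | u x t = h} = ∅ ∧
        (hbar < h → closure {x | u x t < h} = {x | u x t ≤ h}) ∧
        (h < hbar → {x | u x t < h} = interior {x | u x t ≤ h})) ∧
      (∀ t, 0 ≤ t →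
        (hbar < h →
          {x | u x t = h} = frontier (NonlocalHJ.parD u₀ h (NonlocalHJ.deltaD f Θ u₀ t h))) ∧
        (h < hbar →
          {x | u x t = h} = frontier (NonlocalHJ.parE u₀ h (NonlocalHJ.deltaE f Θ u₀ t h))))) ∧
    -- (b)
    (¬ NonlocalHJ.IsThreshold f Θ u₀ h →
      (hbar < h → closure (NonlocalHJ.subD u₀ h) ⊂ NonlocalHJ.subE u₀ h) →
      (h < hbar → NonlocalHJ.subD u₀ h ⊂ interior (NonlocalHJ.subE u₀ h)) →
      ∀ t, 0 < t → NonlocalHJ.deltaD f Θ u₀ t h < NonlocalHJ.deltaE f Θ u₀ t h) := by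
  have hs : NonlocalHJ.IsSpeed f (NonlocalHJ.mass Θ univ) := hf.isSpeed _
  have hw : NonlocalHJ.IsFlow f Θ u₀ u := hu.isFlow hΘ
  have hc := hw.continuous_initial
  refine ⟨⟨NonlocalHJ.isMinimalEvolution_deltaD hs hΘ,
    NonlocalHJ.isMaximalEvolution_deltaE hs hΘ⟩, ?_⟩
  rcases lt_or_gt_of_ne hne with hlt | hlt
  · -- below the threshold, everything is read off from `-u` at the level `-h`
    have hlt' : -hbar < -h := neg_lt_neg hlt
    have hthr := (NonlocalHJ.IsThreshold.dual hΘ hc hbar).2 hhbar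
    refine ⟨fun _ hint => ?_, fun hnot _ hint t ht => ?_⟩
    · have hcl : closure (NonlocalHJ.subD (-u₀) (-h)) = NonlocalHJ.subE (-u₀) (-h) := by
        rw [NonlocalHJ.subD_neg, NonlocalHJ.subE_neg, closure_compl, hint hlt]
      have key := fun t (ht : 0 ≤ t) =>
        (hw.dual hΘ).sublevel_eq_parD hs.dual hΘ hthr hlt' hcl ht
      have hset := fun t (ht : 0 ≤ t) =>
        NonlocalHJ.level_set_of_eq NonlocalHJ.isOpen_parD (key t ht).2.1 (key t ht).2.2
      refine ⟨fun t ht => ?_, fun t ht => ⟨?_, fun h' => absurd h' hlt.not_gt, fun _ => ?_⟩,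
        fun t ht => ⟨fun h' => absurd h' hlt.not_gt, fun _ => ?_⟩⟩
      · rw [NonlocalHJ.deltaE_eq_neg_deltaD hΘ,
        NonlocalHJ.deltaD_eq_neg_deltaE (f := f) (u₀ := u₀) (h := h) hΘ, (key t ht).1]
      · simpa only [neg_inj] using (hset t ht).1
      · have h1 := (hset t ht).2.1
        simp only [neg_lt_neg_iff, neg_le_neg_iff] at h1
        have h2 : {x | u x t < h} = {x | h ≤ u x t}ᶜ := by ext x; simp
        have h3 : {x | u x t ≤ h} = {x | h < u x t}ᶜ := by ext x; simp
        rw [h2, h3, interior_compl, h1]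
      · have h1 := (hset t ht).2.2
        simp only [neg_inj] at h1
        rw [h1, NonlocalHJ.deltaE_eq_neg_deltaD hΘ,
          ← frontier_compl (NonlocalHJ.parE _ _ _), ← NonlocalHJ.parD_neg, neg_neg]
    · rw [NonlocalHJ.deltaE_eq_neg_deltaD hΘ,
        NonlocalHJ.deltaD_eq_neg_deltaE (f := f) (u₀ := u₀) (h := h) hΘ, neg_lt_neg_iff]
      refine NonlocalHJ.deltaD_lt_deltaE hs.dual hΘ hc.neg hthr hlt'
        (fun H => hnot ((NonlocalHJ.IsThreshold.dual hΘ hc h).1 H)) ?_ ht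
      rw [NonlocalHJ.subD_neg, NonlocalHJ.subE_neg, closure_compl]
      exact compl_lt_compl_iff_lt.2 (hint hlt)
  · refine ⟨fun hcl _ => ?_, fun hnot hcl _ t ht =>
      NonlocalHJ.deltaD_lt_deltaE hs hΘ hc hhbar hlt hnot (hcl hlt) ht⟩
    have key := fun t (ht : 0 ≤ t) => hw.sublevel_eq_parD hs hΘ hhbar hlt (hcl hlt) ht
    have hset := fun t (ht : 0 ≤ t) =>
      NonlocalHJ.level_set_of_eq NonlocalHJ.isOpen_parD (key t ht).2.1 (key t ht).2.2
    exact ⟨fun t ht => (key t ht).1,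
      fun t ht => ⟨(hset t ht).1, fun _ => (hset t ht).2.1, fun h' => absurd h' hlt.not_gt⟩,
      fun t ht => ⟨fun _ => (hset t ht).2.2, fun h' => absurd h' hlt.not_gt⟩⟩
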